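/- Let $\Pi=\{x+iy : x\in\mathbb R,\ y>0\}$, $\mathbb R_+=(0,\infty)$, $1\le p,q<\infty$, $\lambda>-1$, and put $d\nu_\lambda(y)=(\lambda+1)(2y)^\lambda\,dy$ on $\mathbb R_+$ and $d\mu_\lambda(x+iy)=\frac1\pi(\lambda+1)(2y)^\lambda\,dx\,dy$ on $\Pi$. **Spaces.** Let $\mathcal D_t(\Pi)$ be the space of smooth functions on $\Pi$ that (with all derivatives) are rapidly decreasing in $x$ and have compact support in $y\in\mathbb R_+$, and let $\mathcal D_t(\Pi)'$ be its dual. For $f\in\mathcal D_t(\Pi)'$ let $\widehat f(\xi,y)$ be the distributional Fourier transform in the first variable, normalized by $\widehat\varphi(\xi,y)=\frac1{\sqrt{2\pi}}\int_{\mathbb R}e^{-i\xi x}\varphi(x,y)\,dx$. The space $\mathcal L^{q,p}_\lambda(\Pi)$ consists of those $f\in\mathcal D_t(\Pi)'$ for which $\widehat f$ is a locally Bochner integrable function $\xi\mapsto\widehat f(\xi,\cdot)$ from $\mathbb R$ to $L^p(\mathbb R_+,\nu_\lambda)$ and $$\|f\|_{\mathcal L^{q,p}_\lambda(\Pi)}=\Big(\int_{\mathbb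 R}\Big\|\tfrac1{\sqrt\pi}\widehat f(\xi,\cdot)\Big\|_{L^p(\mathbb R_+,\nu_\lambda)}^q d\xi\Big)^{1/q}<\infty .$$ Let $\mathcal A^{q,p}_\lambda(\Pi)$ be the set of those elements of $\mathcal L^{q,p}_\lambda(\Pi)$ which are holomorphic functions on $\Pi$. **The operator $R_\lambda$.** For $x>0$ put $$\theta_{\lambda,p}(x)=\Big(\frac{p^{\lambda+1}x^{\lambda+1}}{2^\lambda\Gamma(\lambda+2)}\Big)^{1/p},$$ and let $\beta_\lambda(x,\cdot)$ be the inverse function of $\psi_\lambda(x,t)=\ln\frac{\Gamma(\lambda+1)}{\Gamma(\lambda+1,pxt)}$, $t>0$, where $\Gamma(a,b)=\int_b^\infty t^{a-1}e^{-t}\,dt$. Define $R_\lambda=R_0^{-1}U_{2,\lambda}U_{1,\lambda}$, where $U_{1,\lambda}f=\frac1{\sqrt\pi}\widehat f$ and, for almost every $x$, $$(U_{2,\lambda}\varphi)(x,y)=\frac{1}{\theta_{\lambda,p}(|x|)}\,e^{-\frac yp+|x|\beta_\lambda(|x|,y)}\,\varphi(x,\beta_\lambda(|x|,y)),\qquad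 (R_0^{-1}\varphi)(x)=\chi_{\mathbb R_+}(x)\int_0^\infty\varphi(x,\eta)\,e^{-\frac{(p-1)\eta}{p}}\,d\eta .$$ **Theorem.** For every $f\in\mathcal A^{q,p}_\lambda(\Pi)$ one has $R_\lambda f\in L^q(\mathbb R_+)$ and $$\|f\|_{\mathcal L^{q,p}_\lambda(\Pi)}=\|R_\lambda f\|_{L^q(\mathbb R_+)} .$$ Moreover, for almost every $x>0$, $$(R_\lambda f)(x)=\frac{1}{\sqrt2}\,\theta_{\lambda,p}^{p-1}(x)\int_{\Pi}f(\omega)\,e^{-ix\overline\omega}\,e^{-x(p-2)\operatorname{Im}\omega}\,d\mu_\lambda(\omega)$$ in the following sense. With $\omega=\xi+i\eta$, the integral over $\Pi$ is the iterated integral in which the integration over $\xi$ is the distributional Fourier transform, i.e. $\int_{\mathbb R}f(\xi+i\eta)e^{-ix\xi}\,d\xi$ stands for $\sqrt{2\pi}\,\widehat f(x,\eta)$; thus for almost every $x>0$ $$(R_\lambda f)(x)=\frac{1}{\sqrt2}\,\theta_{\lambda,p}^{p-1}(x)\int_0^\infty\frac1\pi\sqrt{2\pi}\,\widehat f(x,\eta)\,e^{-x\eta}e^{-x(p-2)\eta}\,d\nu_\lambda(\eta),$$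 the last integral being absolutely convergent. If $f(\cdot+i\eta)\in L^1(\mathbb R)$ for almost every $\eta>0$, then for almost every $x>0$ the formula holds with the ordinary iterated integral (over $\xi$ first, then over $\eta$), and for almost every $x>0$ for which the integrand is $\mu_\lambda$-integrable over $\Pi$ it holds with the ordinary integral over $\Pi$. -/

import Mathlib

open MeasureTheory Set
open scoped ENNReal SchwartzMap

noncomputable section

namespace MixedFourier

/-! ### Test functions and distributions tempered in the first variable -/

/-- `φ` vanishes outside the strip `ℝ × K`. -/
def SupportedIn (K : Set ℝ) (φ : 𝓢(ℝ × ℝ, ℂ)) : Prop :=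
  ∀ x y : ℝ, y ∉ K → φ (x, y) = 0

/-- The test space `𝓓ₜ(Π)` on the upper half-plane `Π = ℝ × (0, ∞)`: smooth functions of rapid
decay in `x` and of compact support in `y ∈ (0, ∞)`. Extended by zero to `ℝ × ℝ`, these are the
Schwartz functions supported in `ℝ × K` for some compact `K ⊆ (0, ∞)`. -/
def Dt : Submodule ℂ 𝓢(ℝ × ℝ, ℂ) where
  carrier := {φ | ∃ K : Set ℝ, IsCompact K ∧ K ⊆ Ioi 0 ∧ SupportedIn K φ}
  zero_mem' := ⟨∅, isCompact_empty, empty_subset _, fun _ _ _ => rfl⟩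
  add_mem' := by
    rintro φ ψ ⟨K, hK, hK0, hφ⟩ ⟨L, hL, hL0, hψ⟩
    refine ⟨K ∪ L, hK.union hL, union_subset hK0 hL0, fun x y hy => ?_⟩
    have h1 := hφ x y (fun h => hy (Or.inl h))
    have h2 := hψ x y (fun h => hy (Or.inr h))
    simp [h1, h2]
  smul_mem' := by
    rintro c φ ⟨K, hK, hK0, hφ⟩
    refine ⟨K, hK, hK0, fun x y hy => ?_⟩
    have h1 := hφ x y hy
    simp [h1]

/-- The dual `𝓓ₜ(Π)'`. The space `𝓓ₜ(Π)` is the inductive limit of its subspaces of functions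
supported in `ℝ × K`, `K ⊆ (0, ∞)` compact, each with the Schwartz topology; so a linear functional
is continuous when its restriction to each of these subspaces is. -/
structure DtDual where
  toLinearMap : Dt →ₗ[ℂ] ℂ
  cont : ∀ K : Set ℝ, IsCompact K → K ⊆ Ioi 0 →
    ContinuousOn toLinearMap {φ : Dt | SupportedIn K (φ : 𝓢(ℝ × ℝ, ℂ))}

instance : CoeFun DtDual (fun _ => Dt → ℂ) := ⟨fun T => T.toLinearMap⟩

/-- `ψ` is the Fourier transform of `φ` in the first variable, with the normalization
`(2π)^(-1/2) ∫ e^{-i x ξ} φ(ξ, y) dξ`. This transform maps `𝓓ₜ(Π)` bijectively onto itself, so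
each `φ` has exactly one such `ψ`, and each `ψ` comes from exactly one `φ`. -/
def IsFourierFst (φ ψ : Dt) : Prop :=
  ∀ x y : ℝ, (ψ : 𝓢(ℝ × ℝ, ℂ)) (x, y) =
    (1 / Real.sqrt (2 * Real.pi) : ℝ) *
      ∫ ξ : ℝ, Complex.exp (-(Complex.I * x * ξ)) * (φ : 𝓢(ℝ × ℝ, ℂ)) (ξ, y)

/-- The function `F` on the upper half-plane, regarded as a distribution, is `T`
(compactly supported test functions are dense in `𝓓ₜ(Π)`). -/
def Represents (T : DtDual) (F : ℂ → ℂ) : Prop :=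
  ∀ φ : Dt, HasCompactSupport (φ : 𝓢(ℝ × ℝ, ℂ)) →
    T φ = ∫ z : ℝ × ℝ, F ((z.1 : ℂ) + (z.2 : ℂ) * Complex.I) * (φ : 𝓢(ℝ × ℝ, ℂ)) z

/-! ### Mixed norm spaces -/

/-- The measure `dν_λ(y) = (λ + 1) (2y)^λ dy` on `(0, ∞)`. -/
def nu (lam : ℝ) : Measure ℝ :=
  (volume.restrict (Ioi 0)).withDensity (fun y => ENNReal.ofReal ((lam + 1) * (2 * y) ^ lam))

/-- The measure `dμ_λ(x, y) = π⁻¹ (λ + 1) (2y)^λ dx dy` on the upper half-plane. -/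
def mu (lam : ℝ) : Measure (ℝ × ℝ) :=
  ENNReal.ofReal (1 / Real.pi) • (volume : Measure ℝ).prod (nu lam)

/-- `L^{q,p}_λ(Π)`: Bochner measurable `φ : ℝ → L^p((0, ∞), ν_λ)` with
`‖φ(·)‖_{L^p} ∈ L^q(ℝ)` (such `φ` are locally Bochner integrable, as `q ≥ 1`). -/
abbrev MixedLp (lam : ℝ) (p q : ℝ≥0∞) [Fact (1 ≤ p)] : Type :=
  Lp (Lp ℂ p (nu lam)) q (volume : Measure ℝ)

/-- The value `φ(x, y)` of (a representative of) `φ ∈ L^{q,p}_λ(Π)`. -/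
def MixedLp.eval {lam : ℝ} {p q : ℝ≥0∞} [Fact (1 ≤ p)] (φ : MixedLp lam p q) (x y : ℝ) : ℂ :=
  (φ x : ℝ → ℂ) y

/-- The distributional Fourier transform of `T` in the first variable is `g`, that is,
`⟨T, φ̂⟩ = ∫∫ g(ξ, y) φ(ξ, y) dy dξ` for all test functions `φ`. -/
def IsFourierTransform {lam : ℝ} {p q : ℝ≥0∞} [Fact (1 ≤ p)]
    (T : DtDual) (g : MixedLp lam p q) : Prop :=
  ∀ φ ψ : Dt, IsFourierFst φ ψ →
    T ψ = ∫ ξ : ℝ, ∫ y in Ioi (0 : ℝ), g.eval ξ y * (φ : 𝓢(ℝ × ℝ, ℂ)) (ξ, y)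

/-- The mixed-Fourier-norm space `𝓛^{q,p}_λ(Π)`. -/
def calL (lam : ℝ) (p q : ℝ≥0∞) [Fact (1 ≤ p)] : Set DtDual :=
  {T | ∃ g : MixedLp lam p q, IsFourierTransform T g}

open Classical in
/-- The Fourier transform `f̂(ξ, y)` in the first variable of `f ∈ 𝓛^{q,p}_λ(Π)`. -/
def fourierFst (lam : ℝ) (p q : ℝ≥0∞) [Fact (1 ≤ p)] (T : DtDual) : MixedLp lam p q :=
  if h : ∃ g : MixedLp lam p q, IsFourierTransform T g then h.choose else 0

/-- `U_{1,λ} f = π^(-1/2) f̂`. -/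
def U1 (lam : ℝ) (p q : ℝ≥0∞) [Fact (1 ≤ p)] (T : DtDual) : MixedLp lam p q :=
  ((1 / Real.sqrt Real.pi : ℝ) : ℂ) • fourierFst lam p q T

/-- The norm `‖f‖ = (∫ ‖π^(-1/2) f̂(ξ, ·)‖_{L^p(ν_λ)}^q dξ)^(1/q)` of `𝓛^{q,p}_λ(Π)`. -/
def calLNorm (lam : ℝ) (p q : ℝ≥0∞) [Fact (1 ≤ p)] (T : DtDual) : ℝ :=
  ‖U1 lam p q T‖

/-- `𝓐^{q,p}_λ(Π) = Hol(Π) ∩ 𝓛^{q,p}_λ(Π)`. -/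
def calA (lam : ℝ) (p q : ℝ≥0∞) [Fact (1 ≤ p)] : Set DtDual :=
  {T | T ∈ calL lam p q ∧
    ∃ F : ℂ → ℂ, DifferentiableOn ℂ F {z | 0 < z.im} ∧ Represents T F}

/-! ### The operator `R_λ = R₀⁻¹ U_{2,λ} U_{1,λ}` -/

/-- `θ_{λ,p}(x) = (p^{λ+1} x^{λ+1} / (2^λ Γ(λ+2)))^{1/p}`. -/
def theta (lam p x : ℝ) : ℝ :=
  (p ^ (lam + 1) * x ^ (lam + 1) / (2 ^ lam * Real.Gamma (lam + 2))) ^ (1 / p)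

/-- The upper incomplete Gamma function `Γ(a, b) = ∫_b^∞ t^{a-1} e^{-t} dt`. -/
def incGamma (a b : ℝ) : ℝ :=
  ∫ t in Ioi b, t ^ (a - 1) * Real.exp (-t)

/-- `ψ_λ(x, t) = ln (Γ(λ+1) / Γ(λ+1, p x t))`. -/
def psi (lam p x t : ℝ) : ℝ :=
  Real.log (Real.Gamma (lam + 1) / incGamma (lam + 1) (p * x * t))

/-- `β_λ(x, ·)`, the inverse of `t ↦ ψ_λ(x, t)` on `(0, ∞)`. -/
def beta (lam p x : ℝ) : ℝ → ℝ :=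
  Function.invFunOn (psi lam p x) (Ioi 0)

/-- `(U_{2,λ} φ)(x, y) = θ(|x|)⁻¹ e^{-y/p + |x| β(|x|, y)} φ(x, β(|x|, y))`. -/
def U2 (lam p : ℝ) (φ : ℝ → ℝ → ℂ) (x y : ℝ) : ℂ :=
  ((1 / theta lam p |x| * Real.exp (-(y / p) + |x| * beta lam p |x| y) : ℝ) : ℂ) *
    φ x (beta lam p |x| y)

/-- `(R₀⁻¹ φ)(x) = χ₊(x) ∫_0^∞ φ(x, η) ℓ(η)^{p-1} dη`, where `ℓ(η) = e^{-η/p}`. -/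
def R0inv (p : ℝ) (φ : ℝ → ℝ → ℂ) (x : ℝ) : ℂ :=
  (Ioi (0 : ℝ)).indicator
    (fun x => ∫ η in Ioi (0 : ℝ), φ x η * ((Real.exp (-(η / p)) ^ (p - 1) : ℝ) : ℂ)) x

/-- `R_λ = R₀⁻¹ U_{2,λ} U_{1,λ}`. -/
def R (lam : ℝ) (p q : ℝ≥0∞) [Fact (1 ≤ p)] (T : DtDual) : ℝ → ℂ :=
  R0inv p.toReal (U2 lam p.toReal (U1 lam p q T).eval)

/-- The weight `e^{-i x w̄} e^{-x (p-2) Im w}` at `w = ξ + i η`. -/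
def kernel (p x ξ η : ℝ) : ℂ :=
  Complex.exp (-(Complex.I * x * ((ξ : ℂ) - Complex.I * η))) *
    ((Real.exp (-(x * (p - 2) * η)) : ℝ) : ℂ)

end MixedFourier

end

/-!
The statement rests on the form of the Fourier transform: for `f ∈ 𝓐^{q,p}_λ(Π)`, almost every
`f̂(ξ, ·)` is an exponential `c(ξ) e^{-ξy}`, with `c = 0` on `(-∞, 0]`
(`exists_exponential_form`).

The Cauchy–Riemann equation `(∂_x + i ∂_y) F = 0`, tested against `a(x) b(y)`, becomes after a
Fourier transform in `x` the weak equation `u' = -ξ u` for `u = f̂(ξ, ·)`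
(`ae_integral_eval_deriv_sub`). The function `F` may be tested only against compactly supported
functions, which yields orthogonality to the inverse Fourier transforms of compactly supported `a`.
Since this class is invariant under modulations, and hence separates functions
(`ae_eq_zero_of_integral_fourierInv_mul`), no density argument in the space of test functions is
needed. The exceptional set of `ξ` depends on `b`; a separability argument
(`ae_forall_integral_deriv_sub`) removes this dependence. Then `e^{ξy} u` has vanishing weak
derivative, so `u` is an exponential, and membership in `L^p(ν_λ)` excludes `ξ ≤ 0`.

The substitution `η = ψ_λ(x, t)` satisfies `e^{-η} dη = θ(x)^p e^{-pxt} dν_λ(t)` and turns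
`R₀⁻¹ U_{2,λ}` into an integral against `e^{-x(p-1)t} dν_λ(t)` (`R0inv_U2`); this is the integral
formula. Because `e^{-xy}` has norm `θ(x)⁻¹` in `L^p(ν_λ)` (`eLpNorm_exp_nu`), the formula gives
`R_λ f = π^{-1/2} c / θ` on `(0, ∞)`, and the right-hand side has modulus
`‖π^{-1/2} f̂(x, ·)‖`; this is the norm identity.

For the ordinary integrals, `c(ξ) e^{-ξη}` is integrable in `ξ` for every `η > 0`
(`integrable_coeff_mul_exp`), and testing against `a(x) b(y)` once more shows that its inverse
Fourier transform is `F(· + iη)`, first in the weak sense (`integral_slice_mul_rescale`) and, when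
the slice is integrable, in the ordinary sense (`ae_integral_slice_exp`). An exchange of almost
everywhere quantifiers and Fubini's theorem finish the proof.
-/

namespace MixedFourier

open Filter Topology
open scoped ContDiff FourierTransform

/-! ### The incomplete Gamma function and the substitution `η = ψ_λ(x, t)` -/

section

section IncompleteGamma

variable {a : ℝ}

theorem integrableOn_incGamma (ha : 0 < a) {b : ℝ} (hb : 0 ≤ b) :
    IntegrableOn (fun t : ℝ => t ^ (a - 1) * Real.exp (-t)) (Ioi b) := by
  have h := Real.GammaIntegral_convergent ha
  simp only [mul_comm (Real.exp _)] at h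
  exact h.mono_set (Ioi_subset_Ioi hb)

theorem incGamma_eq_sub (ha : 0 < a) {b : ℝ} (hb : 0 ≤ b) :
    incGamma a b = Real.Gamma a - ∫ t in (0 : ℝ)..b, t ^ (a - 1) * Real.exp (-t) := by
  have h := integrableOn_incGamma ha le_rfl
  rw [Real.Gamma_eq_integral ha, intervalIntegral.integral_of_le hb, incGamma, eq_sub_iff_add_eq,
    add_comm]
  simp only [mul_comm (Real.exp _)]
  rw [← setIntegral_union Ioc_disjoint_Ioi_same measurableSet_Ioi (h.mono_set Ioc_subset_Ioi_self)
    (h.mono_set (Ioi_subset_Ioi hb)), Ioc_union_Ioi_eq_Ioi hb]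

theorem incGamma_pos (ha : 0 < a) {b : ℝ} (hb : 0 ≤ b) : 0 < incGamma a b := by
  rw [incGamma, setIntegral_pos_iff_support_of_nonneg_ae]
  · have : Function.support (fun t : ℝ => t ^ (a - 1) * Real.exp (-t)) ∩ Ioi b = Ioi b := by
      refine inter_eq_right.2 fun t ht => ?_
      have : 0 < t := lt_of_le_of_lt hb ht
      exact (by positivity : 0 < t ^ (a - 1) * Real.exp (-t)).ne'
    rw [this]
    simp
  · filter_upwards [ae_restrict_mem measurableSet_Ioi] with t ht
    have : 0 < t := lt_of_le_of_lt hb ht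
    simp only [Pi.zero_apply]
    positivity
  · exact integrableOn_incGamma ha hb

theorem hasDerivAt_incGamma (ha : 0 < a) {b : ℝ} (hb : 0 < b) :
    HasDerivAt (incGamma a) (-(b ^ (a - 1) * Real.exp (-b))) b := by
  have hc : ContinuousAt (fun t : ℝ => t ^ (a - 1) * Real.exp (-t)) b :=
    (Real.continuousAt_rpow_const _ _ (Or.inl hb.ne')).mul (by fun_prop)
  have hi : IntervalIntegrable (fun t : ℝ => t ^ (a - 1) * Real.exp (-t)) volume 0 b :=
    (intervalIntegrable_iff_integrableOn_Ioc_of_le hb.le).2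
      ((integrableOn_incGamma ha le_rfl).mono_set Ioc_subset_Ioi_self)
  have h := (intervalIntegral.integral_hasDerivAt_right hi
    ⟨Ioi 0, Ioi_mem_nhds hb, (integrableOn_incGamma ha le_rfl).aestronglyMeasurable⟩ hc).const_sub
      (Real.Gamma a)
  refine h.congr_of_eventuallyEq ?_
  filter_upwards [Ioi_mem_nhds hb] with t ht
  exact incGamma_eq_sub ha (le_of_lt ht)

theorem tendsto_incGamma_zero (ha : 0 < a) :
    Tendsto (incGamma a) (𝓝[>] 0) (𝓝 (Real.Gamma a)) := by
  have hi : IntegrableOn (fun t : ℝ => t ^ (a - 1) * Real.exp (-t)) (uIcc 0 1) := by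
    rw [uIcc_of_le zero_le_one, integrableOn_Icc_iff_integrableOn_Ioc]
    exact (integrableOn_incGamma ha le_rfl).mono_set Ioc_subset_Ioi_self
  have h := intervalIntegral.continuousOn_primitive_interval hi 0 (by simp)
  have h1 : Tendsto (fun b : ℝ => ∫ t in (0 : ℝ)..b, t ^ (a - 1) * Real.exp (-t)) (𝓝[>] 0)
      (𝓝 0) := by
    have h2 := h.tendsto
    rw [intervalIntegral.integral_same] at h2
    refine h2.mono_left ?_
    rw [uIcc_of_le zero_le_one, ← nhdsWithin_Ioo_eq_nhdsGT (zero_lt_one' ℝ)]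
    exact nhdsWithin_mono _ Ioo_subset_Icc_self
  have h3 := h1.const_sub (Real.Gamma a)
  rw [sub_zero] at h3
  refine h3.congr' ?_
  filter_upwards [self_mem_nhdsWithin] with b hb
  exact (incGamma_eq_sub ha (le_of_lt hb)).symm

theorem tendsto_incGamma_atTop (ha : 0 < a) : Tendsto (incGamma a) atTop (𝓝[>] 0) := by
  refine tendsto_nhdsWithin_iff.2 ⟨?_, ?_⟩
  · have h1 := (intervalIntegral_tendsto_integral_Ioi 0 (integrableOn_incGamma ha le_rfl)
      tendsto_id).const_sub (Real.Gamma a)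
    have h2 : Real.Gamma a - ∫ t in Ioi (0 : ℝ), t ^ (a - 1) * Real.exp (-t) = 0 := by
      rw [Real.Gamma_eq_integral ha]
      simp [mul_comm]
    rw [h2] at h1
    refine h1.congr' ?_
    filter_upwards [eventually_ge_atTop 0] with b hb
    exact (incGamma_eq_sub ha hb).symm
  · filter_upwards [eventually_ge_atTop 0] with b hb
    exact incGamma_pos ha hb

end IncompleteGamma

section ChangeOfVariable

variable {lam p x : ℝ}

theorem psi_eq (hlam : -1 < lam) (hp : 0 < p) (hx : 0 < x) {t : ℝ} (ht : 0 ≤ t) :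
    psi lam p x t = Real.log (Real.Gamma (lam + 1)) - Real.log (incGamma (lam + 1) (p * x * t)) :=
  Real.log_div (Real.Gamma_pos_of_pos (by linarith)).ne'
    (incGamma_pos (by linarith) (by positivity)).ne'

theorem hasDerivAt_psi (hlam : -1 < lam) (hp : 0 < p) (hx : 0 < x) {t : ℝ} (ht : 0 < t) :
    HasDerivAt (psi lam p x)
      (p * x * ((p * x * t) ^ lam * Real.exp (-(p * x * t))) / incGamma (lam + 1) (p * x * t))
      t := by
  have hpos : 0 < p * x * t := by positivity
  have h1 := hasDerivAt_incGamma (a := lam + 1) (by linarith) hpos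
  have h2 : HasDerivAt (fun t : ℝ => p * x * t) (p * x) t := by
    simpa using (hasDerivAt_id t).const_mul (p * x)
  have h3 := ((h1.comp t h2).log (incGamma_pos (by linarith) hpos.le).ne').const_sub
    (Real.log (Real.Gamma (lam + 1)))
  refine (h3.congr_of_eventuallyEq ?_).congr_deriv ?_
  · filter_upwards [Ioi_mem_nhds ht] with s hs
    exact psi_eq hlam hp hx (le_of_lt hs)
  · simp only [add_sub_cancel_right, Function.comp]
    ring

theorem strictMonoOn_psi (hlam : -1 < lam) (hp : 0 < p) (hx : 0 < x) :
    StrictMonoOn (psi lam p x) (Ioi 0) := by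
  refine strictMonoOn_of_deriv_pos (convex_Ioi 0)
    (fun t ht => (hasDerivAt_psi hlam hp hx ht).continuousAt.continuousWithinAt) ?_
  intro t ht
  rw [interior_Ioi] at ht
  rw [(hasDerivAt_psi hlam hp hx ht).deriv]
  have ht' : 0 < t := ht
  have := incGamma_pos (a := lam + 1) (by linarith) (by positivity : 0 ≤ p * x * t)
  positivity

theorem tendsto_psi_zero (hlam : -1 < lam) (hp : 0 < p) (hx : 0 < x) :
    Tendsto (psi lam p x) (𝓝[>] 0) (𝓝 0) := by
  have hlin : Tendsto (fun t : ℝ => p * x * t) (𝓝[>] 0) (𝓝[>] 0) := by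
    refine tendsto_nhdsWithin_iff.2 ⟨?_, ?_⟩
    · have : Tendsto (fun t : ℝ => p * x * t) (𝓝 0) (𝓝 (p * x * 0)) :=
        Continuous.tendsto (by fun_prop) 0
      rw [mul_zero] at this
      exact this.mono_left nhdsWithin_le_nhds
    · filter_upwards [self_mem_nhdsWithin] with t ht
      have : 0 < t := ht
      exact (by positivity : 0 < p * x * t)
  have hG : 0 < Real.Gamma (lam + 1) := Real.Gamma_pos_of_pos (by linarith)
  have h := (((tendsto_incGamma_zero (a := lam + 1) (by linarith)).comp hlin).log
    hG.ne').const_sub (Real.log (Real.Gamma (lam + 1)))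
  rw [sub_self] at h
  refine h.congr' ?_
  filter_upwards [self_mem_nhdsWithin] with t ht
  exact (psi_eq hlam hp hx (le_of_lt ht)).symm

theorem tendsto_psi_atTop (hlam : -1 < lam) (hp : 0 < p) (hx : 0 < x) :
    Tendsto (psi lam p x) atTop atTop := by
  have hlin : Tendsto (fun t : ℝ => p * x * t) atTop atTop :=
    tendsto_id.const_mul_atTop (by positivity)
  have h := Real.tendsto_log_nhdsGT_zero.comp
    ((tendsto_incGamma_atTop (a := lam + 1) (by linarith)).comp hlin)
  have h2 := tendsto_atTop_add_const_left _ (Real.log (Real.Gamma (lam + 1)))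
    (tendsto_neg_atBot_atTop.comp h)
  refine h2.congr' ?_
  filter_upwards [eventually_ge_atTop 0] with t ht
  rw [psi_eq hlam hp hx ht]
  simp [sub_eq_add_neg]

/-- With `strictMonoOn_psi`, `ψ_λ(x, ·)` is a bijection of `(0, ∞)`, so `β_λ(x, ·)` is its genuine
inverse there. -/
theorem image_psi (hlam : -1 < lam) (hp : 0 < p) (hx : 0 < x) :
    psi lam p x '' Ioi 0 = Ioi 0 := by
  have hmono := strictMonoOn_psi hlam hp hx
  have hcont : ContinuousOn (psi lam p x) (Ioi 0) :=
    fun t ht => (hasDerivAt_psi hlam hp hx ht).continuousAt.continuousWithinAt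
  apply Subset.antisymm
  · rintro _ ⟨t, ht, rfl⟩
    have ht' : (0 : ℝ) < t := ht
    have h2 : 0 < t / 2 := by positivity
    -- the values near `0` are at most `ψ (t / 2)`, so the limit `0` is, and `ψ (t / 2) < ψ t`
    have hle : 0 ≤ psi lam p x (t / 2) := by
      refine le_of_tendsto (tendsto_psi_zero hlam hp hx) ?_
      filter_upwards [Ioo_mem_nhdsGT h2] with s hs
      exact (hmono hs.1 h2 hs.2).le
    exact hle.trans_lt (hmono h2 ht' (by linarith))
  · exact isPreconnected_Ioi.intermediate_value_Ioi (l₁ := 𝓝[>] 0) (l₂ := atTop)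
      (le_principal_iff.2 self_mem_nhdsWithin)
      (le_principal_iff.2 (Ioi_mem_atTop 0)) hcont (tendsto_psi_zero hlam hp hx)
      (tendsto_psi_atTop hlam hp hx)

theorem beta_psi (hlam : -1 < lam) (hp : 0 < p) (hx : 0 < x) {t : ℝ} (ht : 0 < t) :
    beta lam p x (psi lam p x t) = t :=
  (strictMonoOn_psi hlam hp hx).injOn.leftInvOn_invFunOn ht

theorem theta_pos (hlam : -1 < lam) (hp : 0 < p) (hx : 0 < x) : 0 < theta lam p x := by
  have := Real.Gamma_pos_of_pos (by linarith : 0 < lam + 2)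
  unfold theta
  positivity

theorem theta_rpow (hlam : -1 < lam) (hp : 0 < p) (hx : 0 < x) :
    theta lam p x ^ p = (p * x) ^ (lam + 1) / (2 ^ lam * Real.Gamma (lam + 2)) := by
  have := Real.Gamma_pos_of_pos (by linarith : 0 < lam + 2)
  rw [theta, ← Real.rpow_mul (by positivity), one_div_mul_cancel hp.ne', Real.rpow_one,
    Real.mul_rpow hp.le hx.le]

/-- Integration against `ν_λ` as an integral over `(0, ∞)`. -/
theorem integral_nu (hlam : -1 < lam) (F : ℝ → ℂ) :
    ∫ t, F t ∂(nu lam) = ∫ t in Ioi (0 : ℝ), (((lam + 1) * (2 * t) ^ lam : ℝ) : ℂ) * F t := by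
  rw [nu, integral_withDensity_eq_integral_toReal_smul₀ (by fun_prop) (by simp)]
  refine setIntegral_congr_fun measurableSet_Ioi fun t ht => ?_
  have ht' : (0 : ℝ) < t := ht
  have : 0 ≤ (lam + 1) * (2 * t) ^ lam := mul_nonneg (by linarith) (by positivity)
  simp [ENNReal.toReal_ofReal this, Complex.real_smul]

/-- The substitution `η = ψ_λ(x, t)` turns `R₀⁻¹ U_{2,λ}` into integration against
`e^{-x(p-1)t} dν_λ(t)`: by definition of `ψ_λ`, `e^{-η} dη = θ(x)^p e^{-pxt} dν_λ(t)`. -/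
theorem R0inv_U2 (hlam : -1 < lam) (hp : 0 < p) (hx : 0 < x) (φ : ℝ → ℝ → ℂ) :
    R0inv p (U2 lam p φ) x =
      ((theta lam p x ^ (p - 1) : ℝ) : ℂ) *
        ∫ t, φ x t * ((Real.exp (-(x * (p - 1) * t)) : ℝ) : ℂ) ∂(nu lam) := by
  have hx' : x ∈ Ioi (0 : ℝ) := hx
  rw [R0inv, indicator_of_mem hx']
  have key := integral_image_eq_integral_abs_deriv_smul (s := Ioi (0 : ℝ)) (f := psi lam p x)
    measurableSet_Ioi (fun t ht => (hasDerivAt_psi hlam hp hx ht).hasDerivWithinAt)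
    (strictMonoOn_psi hlam hp hx).injOn
    (fun η => U2 lam p φ x η * ((Real.exp (-(η / p)) ^ (p - 1) : ℝ) : ℂ))
  rw [image_psi hlam hp hx] at key
  rw [key, integral_nu hlam, ← integral_const_mul]
  refine setIntegral_congr_fun measurableSet_Ioi fun t ht => ?_
  have ht' : (0 : ℝ) < t := ht
  have hs : 0 < p * x * t := by positivity
  have hI := incGamma_pos (a := lam + 1) (by linarith) hs.le
  have hG : 0 < Real.Gamma (lam + 1) := Real.Gamma_pos_of_pos (by linarith)
  have hl : 0 < lam + 1 := by linarith
  have hθ := theta_pos hlam hp hx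
  simp only [U2, abs_of_pos hx, beta_psi hlam hp hx ht', Complex.real_smul]
  rw [abs_of_pos (by positivity)]
  have hexp : Real.exp (-(psi lam p x t)) =
      incGamma (lam + 1) (p * x * t) / Real.Gamma (lam + 1) := by
    rw [psi, ← Real.log_inv, inv_div, Real.exp_log (by positivity)]
  have hmain : p * x * ((p * x * t) ^ lam * Real.exp (-(p * x * t))) /
        incGamma (lam + 1) (p * x * t) *
        (1 / theta lam p x * Real.exp (-(psi lam p x t / p) + x * t) *
          Real.exp (-(psi lam p x t / p)) ^ (p - 1)) =
      theta lam p x ^ (p - 1) * ((lam + 1) * (2 * t) ^ lam *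
        Real.exp (-(x * (p - 1) * t))) := by
    have e1 : Real.exp (-(psi lam p x t / p) + x * t) * Real.exp (-(psi lam p x t / p)) ^ (p - 1) =
        incGamma (lam + 1) (p * x * t) / Real.Gamma (lam + 1) * Real.exp (x * t) := by
      rw [← hexp, ← Real.exp_mul, ← Real.exp_add, ← Real.exp_add]
      congr 1
      field_simp
      ring
    have e2 : Real.exp (-(x * (p - 1) * t)) = Real.exp (-(p * x * t)) * Real.exp (x * t) := by
      rw [← Real.exp_add]
      congr 1
      ring
    have e3 : theta lam p x ^ (p - 1) = theta lam p x ^ p / theta lam p x := by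
      rw [Real.rpow_sub hθ, Real.rpow_one]
    have e4 : (p * x) ^ (lam + 1) = (p * x) ^ lam * (p * x) := by
      rw [Real.rpow_add (by positivity), Real.rpow_one]
    have e5 : Real.Gamma (lam + 2) = (lam + 1) * Real.Gamma (lam + 1) := by
      rw [← Real.Gamma_add_one hl.ne']
      ring_nf
    rw [mul_assoc (1 / theta lam p x), e1, e2, e3, theta_rpow hlam hp hx, e4, e5,
      Real.mul_rpow (by positivity : 0 ≤ p * x) ht'.le, Real.mul_rpow zero_le_two ht'.le]
    field_simp
  have hmain' := congrArg (fun r : ℝ => (r : ℂ)) hmain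
  push_cast at hmain' ⊢
  linear_combination (φ x t) * hmain'

end ChangeOfVariable

end

/-! ### The measure `ν_λ` and its exponentials -/

section

variable {lam : ℝ}

theorem ae_nu_iff (hlam : -1 < lam) {P : ℝ → Prop} :
    (∀ᵐ y ∂(nu lam), P y) ↔ ∀ᵐ y ∂(volume : Measure ℝ), y ∈ Ioi (0 : ℝ) → P y := by
  rw [nu, ae_withDensity_iff (by fun_prop), ae_restrict_iff' measurableSet_Ioi]
  refine eventually_congr (Eventually.of_forall fun y => ⟨fun h hy => ?_, fun h hy _ => h hy⟩)
  have hy' : (0 : ℝ) < y := hy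
  have hl : 0 < lam + 1 := by linarith
  refine h hy ?_
  simp only [ne_eq, ENNReal.ofReal_eq_zero, not_le]
  positivity

theorem isLocallyFiniteMeasure_nu (hlam : -1 < lam) : IsLocallyFiniteMeasure (nu lam) := by
  refine ⟨fun x => ⟨Iio (|x| + 1), Iio_mem_nhds (by linarith [le_abs_self x]), ?_⟩⟩
  have hM : 0 ≤ |x| + 1 := by positivity
  have hi : IntegrableOn (fun y : ℝ => (lam + 1) * (2 * y) ^ lam) (Ioc 0 (|x| + 1)) := by
    have h := (intervalIntegral.intervalIntegrable_rpow' (a := 0) (b := |x| + 1) hlam).const_mul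
      ((lam + 1) * 2 ^ lam)
    rw [intervalIntegrable_iff_integrableOn_Ioc_of_le hM] at h
    refine h.congr_fun (fun y hy => ?_) measurableSet_Ioc
    simp only [Real.mul_rpow zero_le_two hy.1.le]
    ring
  rw [nu, withDensity_apply _ measurableSet_Iio, Measure.restrict_restrict measurableSet_Iio]
  have hsub : Iio (|x| + 1) ∩ Ioi 0 ⊆ Ioc 0 (|x| + 1) := fun y hy => ⟨hy.2, le_of_lt hy.1⟩
  exact (lintegral_mono_set hsub).trans_lt hi.lintegral_lt_top

theorem nu_Ioi_one (hlam : -1 < lam) : nu lam (Ioi 1) = ⊤ := by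
  by_contra hfin
  have hl : 0 < lam + 1 := by linarith
  rw [nu, withDensity_apply _ measurableSet_Ioi, Measure.restrict_restrict measurableSet_Ioi,
    inter_eq_left.2 (Ioi_subset_Ioi zero_le_one)] at hfin
  have hi : IntegrableOn (fun y : ℝ => (lam + 1) * (2 * y) ^ lam) (Ioi 1) := by
    refine ⟨(by fun_prop : Measurable _).aestronglyMeasurable, ?_⟩
    rw [hasFiniteIntegral_iff_ofReal]
    · exact lt_top_iff_ne_top.2 hfin
    · filter_upwards [ae_restrict_mem measurableSet_Ioi] with y hy
      have : (0 : ℝ) < y := zero_lt_one.trans hy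
      simp only [Pi.zero_apply]
      positivity
  have hi' : IntegrableOn (fun y : ℝ => y ^ lam) (Ioi 1) := by
    refine IntegrableOn.congr_fun (hi.const_mul ((lam + 1) * 2 ^ lam)⁻¹) (fun y hy => ?_) measurableSet_Ioi
    have hy' : (0 : ℝ) < y := zero_lt_one.trans hy
    simp only [Real.mul_rpow zero_le_two hy'.le]
    field_simp
  linarith [(integrableOn_Ioi_rpow_iff zero_lt_one).1 hi']

theorem integral_exp_nu (hlam : -1 < lam) {s : ℝ} (hs : 0 < s) :
    Integrable (fun y : ℝ => Real.exp (-(s * y))) (nu lam) ∧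
      ∫ y, Real.exp (-(s * y)) ∂(nu lam) = 2 ^ lam * Real.Gamma (lam + 2) / s ^ (lam + 1) := by
  have hl : 0 < lam + 1 := by linarith
  have hval : ∫ y, Real.exp (-(s * y)) ∂(nu lam) =
      2 ^ lam * Real.Gamma (lam + 2) / s ^ (lam + 1) := by
    have h := Real.integral_rpow_mul_exp_neg_mul_Ioi hl hs
    rw [nu, integral_withDensity_eq_integral_toReal_smul₀ (by fun_prop) (by simp)]
    have e : Real.Gamma (lam + 2) = (lam + 1) * Real.Gamma (lam + 1) := by
      rw [← Real.Gamma_add_one hl.ne']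
      ring_nf
    rw [e, show 2 ^ lam * ((lam + 1) * Real.Gamma (lam + 1)) / s ^ (lam + 1) =
      (lam + 1) * 2 ^ lam * ((1 / s) ^ (lam + 1) * Real.Gamma (lam + 1)) by
        rw [one_div, Real.inv_rpow hs.le]; ring, ← h, ← integral_const_mul]
    refine setIntegral_congr_fun measurableSet_Ioi fun t ht => ?_
    have ht' : (0 : ℝ) < t := ht
    simp only [smul_eq_mul]
    rw [ENNReal.toReal_ofReal (by positivity), Real.mul_rpow zero_le_two ht'.le]
    ring_nf
  refine ⟨?_, hval⟩
  by_contra hni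
  rw [integral_undef hni] at hval
  have := Real.Gamma_pos_of_pos (by linarith : 0 < lam + 2)
  exact (by positivity : (0 : ℝ) < 2 ^ lam * Real.Gamma (lam + 2) / s ^ (lam + 1)).ne hval

theorem integral_exp_nu_eq_theta (hlam : -1 < lam) {p x : ℝ} (hp : 0 < p) (hx : 0 < x) :
    ∫ y, Real.exp (-(p * x * y)) ∂(nu lam) = (theta lam p x ^ p)⁻¹ := by
  rw [(integral_exp_nu hlam (by positivity)).2, theta_rpow hlam hp hx, inv_div]

/-- The exponential `c e^{-xy}` has norm `|c| / θ(x)` in `L^p(ν_λ)`. -/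
theorem eLpNorm_exp_nu (hlam : -1 < lam) {p : ℝ≥0∞} (hp1 : 1 ≤ p) (hp : p ≠ ⊤) {x : ℝ}
    (hx : 0 < x) (c : ℂ) :
    eLpNorm (fun y : ℝ => c * ((Real.exp (-(x * y)) : ℝ) : ℂ)) p (nu lam) =
      ENNReal.ofReal (‖c‖ / theta lam p.toReal x) := by
  have hp0 : p ≠ 0 := (zero_lt_one.trans_le hp1).ne'
  have hP : 0 < p.toReal := ENNReal.toReal_pos hp0 hp
  have hθ := theta_pos hlam hP hx
  rw [eLpNorm_eq_lintegral_rpow_enorm_toReal hp0 hp]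
  have e : ∀ y : ℝ, ‖c * ((Real.exp (-(x * y)) : ℝ) : ℂ)‖ₑ ^ p.toReal =
      ENNReal.ofReal (‖c‖ ^ p.toReal * Real.exp (-(p.toReal * x * y))) := by
    intro y
    rw [← ofReal_norm, ENNReal.ofReal_rpow_of_nonneg (norm_nonneg _) hP.le, norm_mul,
      Complex.norm_real, Real.norm_of_nonneg (Real.exp_pos _).le,
      Real.mul_rpow (norm_nonneg _) (Real.exp_pos _).le, ← Real.exp_mul]
    congr 4
    ring
  simp only [e]
  rw [← ofReal_integral_eq_lintegral_ofReal
      ((integral_exp_nu hlam (by positivity)).1.const_mul _)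
      (Eventually.of_forall fun y => by positivity), integral_const_mul,
    integral_exp_nu_eq_theta hlam hP hx, ENNReal.ofReal_rpow_of_nonneg (by positivity)
      (by positivity), ← div_eq_mul_inv, ← Real.div_rpow (norm_nonneg _) hθ.le,
    ← Real.rpow_mul (by positivity), mul_one_div_cancel hP.ne', Real.rpow_one]

/-- A growing or constant exponential `c e^{-xy}`, `x ≤ 0`, is in `L^p(ν_λ)` only if `c = 0`. -/
theorem eq_zero_of_memLp_exp (hlam : -1 < lam) {p : ℝ≥0∞} (hp1 : 1 ≤ p) (hp : p ≠ ⊤) {x : ℝ}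
    (hx : x ≤ 0) {c : ℂ}
    (h : MemLp (fun y : ℝ => c * ((Real.exp (-(x * y)) : ℝ) : ℂ)) p (nu lam)) : c = 0 := by
  have h1 : MemLp (fun _ : ℝ => c) p ((nu lam).restrict (Ioi 1)) := by
    refine (h.restrict (Ioi 1)).of_le aestronglyMeasurable_const ?_
    filter_upwards [ae_restrict_mem measurableSet_Ioi] with y hy
    have hy' : (1 : ℝ) < y := hy
    rw [norm_mul, Complex.norm_real, Real.norm_of_nonneg (Real.exp_pos _).le]
    exact le_mul_of_one_le_right (norm_nonneg _) (Real.one_le_exp (by nlinarith))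
  rw [memLp_const_iff (zero_lt_one.trans_le hp1).ne' hp] at h1
  simpa [nu_Ioi_one hlam] using h1

theorem locallyIntegrableOn_of_memLp_nu (hlam : -1 < lam) {p : ℝ≥0∞} (hp1 : 1 ≤ p) {u : ℝ → ℂ}
    (hu : MemLp u p (nu lam)) : LocallyIntegrableOn u (Ioi 0) := by
  have := isLocallyFiniteMeasure_nu hlam
  have hl : 0 < lam + 1 := by linarith
  rw [locallyIntegrableOn_iff isOpen_Ioi.isLocallyClosed]
  intro K hK hKc
  have h1 : IntegrableOn u K (nu lam) := by
    have : IsFiniteMeasure ((nu lam).restrict K) := ⟨by simpa using hKc.measure_lt_top⟩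
    exact (hu.restrict K).integrable hp1
  rw [IntegrableOn, nu, restrict_withDensity hKc.measurableSet, Measure.restrict_restrict
    hKc.measurableSet, inter_eq_left.2 hK,
    integrable_withDensity_iff_integrable_smul' (by fun_prop) (by simp)] at h1
  have h2 : ContinuousOn (fun y : ℝ => ((lam + 1) * (2 * y) ^ lam)⁻¹) K := by
    intro y hy
    have : (0 : ℝ) < y := hK hy
    refine ContinuousAt.continuousWithinAt (ContinuousAt.inv₀ ?_ (by positivity))
    exact continuousAt_const.mul ((continuousAt_const.mul continuousAt_id).rpow_const
      (Or.inl (mul_pos two_pos this).ne'))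
  refine (IntegrableOn.continuousOn_smul h1 h2 hKc).congr_fun (fun y hy => ?_) hKc.measurableSet
  have hy' : (0 : ℝ) < y := hK hy
  simp only
  rw [ENNReal.toReal_ofReal (by positivity), smul_smul, inv_mul_cancel₀ (by positivity), one_smul]

theorem integrableOn_mul_of_hasCompactSupport {h b : ℝ → ℂ}
    (hh : LocallyIntegrableOn h (Ioi 0)) (hb : Continuous b) (hbc : HasCompactSupport b)
    (hb0 : tsupport b ⊆ Ioi 0) : IntegrableOn (fun y => h y * b y) (Ioi 0) := by
  have h1 : IntegrableOn (fun y => h y * b y) (tsupport b) :=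
    ((hh.mono_set hb0).integrableOn_isCompact hbc).mul_continuousOn hb.continuousOn hbc
  refine ((integrableOn_iff_integrable_of_support_subset fun y hy => ?_).1 h1).integrableOn
  exact subset_tsupport b fun h0 => hy (by simp [h0])

end

/-! ### Tensor products of test functions and the Cauchy–Riemann equation -/

section

variable {lam : ℝ}

/-- Integration against a continuous function with compact support in `(0, ∞)` is a continuous
functional on `L^p(ν_λ)`. -/
theorem exists_clm_integral_mul (hlam : -1 < lam) {p : ℝ≥0∞} [hp1 : Fact (1 ≤ p)] {b : ℝ → ℂ}
    (hb : Continuous b) (hbc : HasCompactSupport b) (hb0 : tsupport b ⊆ Ioi 0) :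
    ∃ L : Lp ℂ p (nu lam) →L[ℂ] ℂ, ∀ u, L u = ∫ y in Ioi (0 : ℝ), u y * b y := by
  have := isLocallyFiniteMeasure_nu hlam
  have hl : 0 < lam + 1 := by linarith
  have hconj := ENNReal.HolderConjugate.inv_one_sub_inv' hp1.out
  have hp' : Fact (1 ≤ (1 - p⁻¹)⁻¹) := by simp [fact_iff]
  -- the density of `ν_λ` has to be divided out
  set b' : ℝ → ℂ := fun y => (((lam + 1) * (2 * y) ^ lam : ℝ) : ℂ)⁻¹ * b y with hb'
  have hcont : Continuous b' := by
    rw [continuous_iff_continuousAt]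
    intro y
    by_cases hy : y ∈ tsupport b
    · have hy0 : (0 : ℝ) < y := hb0 hy
      refine ContinuousAt.mul (ContinuousAt.inv₀ ?_ ?_) hb.continuousAt
      · exact Complex.continuous_ofReal.continuousAt.comp (continuousAt_const.mul
          ((continuousAt_const.mul continuousAt_id).rpow_const (Or.inl (mul_pos two_pos hy0).ne')))
      · exact_mod_cast (by positivity : (lam + 1) * (2 * y) ^ lam ≠ 0)
    · have h0 : b' =ᶠ[𝓝 y] fun _ => 0 := by
        filter_upwards [(isClosed_tsupport b).isOpen_compl.mem_nhds hy] with z hz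
        simp [hb', image_eq_zero_of_notMem_tsupport hz]
      exact continuousAt_const.congr h0.symm
  have hmem : MemLp b' (1 - p⁻¹)⁻¹ (nu lam) :=
    hcont.memLp_of_hasCompactSupport hbc.mul_left
  refine ⟨((ContinuousLinearMap.mul ℂ ℂ).lpPairing (nu lam) p (1 - p⁻¹)⁻¹).flip
    (hmem.toLp b'), fun u => ?_⟩
  rw [ContinuousLinearMap.flip_apply, ContinuousLinearMap.lpPairing_eq_integral]
  have h1 : ∫ y, (ContinuousLinearMap.mul ℂ ℂ) (u y) (hmem.toLp b' y) ∂(nu lam) =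
      ∫ y, u y * b' y ∂(nu lam) := by
    refine integral_congr_ae ?_
    filter_upwards [hmem.coeFn_toLp] with y hy
    simp [hy]
  rw [h1, integral_nu hlam]
  refine setIntegral_congr_fun measurableSet_Ioi fun y hy => ?_
  have hy0 : (0 : ℝ) < y := hy
  have hne : (((lam + 1) * (2 * y) ^ lam : ℝ) : ℂ) ≠ 0 := by
    exact_mod_cast (by positivity : (lam + 1) * (2 * y) ^ lam ≠ 0)
  simp only [hb']
  field_simp

/-- The tensor product `(x, y) ↦ a(x) b(y)` of two Schwartz functions. -/
noncomputable def tensor (a b : 𝓢(ℝ, ℂ)) : 𝓢(ℝ × ℝ, ℂ) where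
  toFun z := a z.1 * b z.2
  smooth' := ((a.smooth ⊤).comp contDiff_fst).mul ((b.smooth ⊤).comp contDiff_snd)
  decay' k n := by
    refine ⟨∑ i ∈ Finset.range (n + 1), (n.choose i : ℝ) *
      (SchwartzMap.seminorm ℝ k i a * SchwartzMap.seminorm ℝ 0 (n - i) b +
        SchwartzMap.seminorm ℝ 0 i a * SchwartzMap.seminorm ℝ k (n - i) b), fun z => ?_⟩
    have ha : ∀ i, ‖iteratedFDeriv ℝ i (fun z : ℝ × ℝ => a z.1) z‖ ≤
        ‖iteratedFDeriv ℝ i a z.1‖ := by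
      intro i
      have h := (ContinuousLinearMap.fst ℝ ℝ ℝ).iteratedFDeriv_comp_right (a.smooth ⊤) z
        (i := i) (by exact_mod_cast le_top)
      change ‖iteratedFDeriv ℝ i (a ∘ (ContinuousLinearMap.fst ℝ ℝ ℝ)) z‖ ≤ _
      rw [h]
      refine (ContinuousMultilinearMap.norm_compContinuousLinearMap_le _ _).trans ?_
      refine mul_le_of_le_one_right (norm_nonneg _) (Finset.prod_le_one (fun _ _ => norm_nonneg _)
        fun _ _ => ContinuousLinearMap.norm_fst_le ..)
    have hb : ∀ i, ‖iteratedFDeriv ℝ i (fun z : ℝ × ℝ => b z.2) z‖ ≤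
        ‖iteratedFDeriv ℝ i b z.2‖ := by
      intro i
      have h := (ContinuousLinearMap.snd ℝ ℝ ℝ).iteratedFDeriv_comp_right (b.smooth ⊤) z
        (i := i) (by exact_mod_cast le_top)
      change ‖iteratedFDeriv ℝ i (b ∘ (ContinuousLinearMap.snd ℝ ℝ ℝ)) z‖ ≤ _
      rw [h]
      refine (ContinuousMultilinearMap.norm_compContinuousLinearMap_le _ _).trans ?_
      refine mul_le_of_le_one_right (norm_nonneg _) (Finset.prod_le_one (fun _ _ => norm_nonneg _)
        fun _ _ => ContinuousLinearMap.norm_snd_le ..)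
    have hz : ‖z‖ ^ k ≤ ‖z.1‖ ^ k + ‖z.2‖ ^ k := by
      rw [Prod.norm_def]
      rcases max_choice ‖z.1‖ ‖z.2‖ with h | h <;> rw [h]
      · exact le_add_of_nonneg_right (by positivity)
      · exact le_add_of_nonneg_left (by positivity)
    calc ‖z‖ ^ k * ‖iteratedFDeriv ℝ n (fun z : ℝ × ℝ => a z.1 * b z.2) z‖
        ≤ (‖z.1‖ ^ k + ‖z.2‖ ^ k) * ∑ i ∈ Finset.range (n + 1), (n.choose i : ℝ) *
            ‖iteratedFDeriv ℝ i (fun z : ℝ × ℝ => a z.1) z‖ *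
            ‖iteratedFDeriv ℝ (n - i) (fun z : ℝ × ℝ => b z.2) z‖ := by
          gcongr
          exact norm_iteratedFDeriv_mul_le ((a.smooth ⊤).comp contDiff_fst)
            ((b.smooth ⊤).comp contDiff_snd) z (by exact_mod_cast le_top)
      _ ≤ _ := by
          rw [Finset.mul_sum]
          refine Finset.sum_le_sum fun i _ => ?_
          have h1 := a.le_seminorm ℝ k i z.1
          have h2 := a.le_seminorm ℝ 0 i z.1
          have h3 := b.le_seminorm ℝ k (n - i) z.2
          have h4 := b.le_seminorm ℝ 0 (n - i) z.2
          simp only [pow_zero, one_mul] at h2 h4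
          calc (‖z.1‖ ^ k + ‖z.2‖ ^ k) * ((n.choose i : ℝ) *
                ‖iteratedFDeriv ℝ i (fun z : ℝ × ℝ => a z.1) z‖ *
                ‖iteratedFDeriv ℝ (n - i) (fun z : ℝ × ℝ => b z.2) z‖)
              ≤ (‖z.1‖ ^ k + ‖z.2‖ ^ k) * ((n.choose i : ℝ) * ‖iteratedFDeriv ℝ i a z.1‖ *
                ‖iteratedFDeriv ℝ (n - i) b z.2‖) := by
                gcongr
                · exact ha i
                · exact hb (n - i)
            _ = (n.choose i : ℝ) *
                ((‖z.1‖ ^ k * ‖iteratedFDeriv ℝ i a z.1‖) * ‖iteratedFDeriv ℝ (n - i) b z.2‖ +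
                ‖iteratedFDeriv ℝ i a z.1‖ *
                  (‖z.2‖ ^ k * ‖iteratedFDeriv ℝ (n - i) b z.2‖)) := by ring
            _ ≤ _ := by gcongr

@[simp]
theorem tensor_apply (a b : 𝓢(ℝ, ℂ)) (z : ℝ × ℝ) : tensor a b z = a z.1 * b z.2 := rfl

/-- `a ⊗ b` as an element of `𝓓ₜ(Π)`, for `b` with compact support in `(0, ∞)`. -/
noncomputable def dtTensor (a b : 𝓢(ℝ, ℂ)) (hbc : HasCompactSupport b) (hb0 : tsupport b ⊆ Ioi 0) : Dt :=
  ⟨tensor a b, tsupport b, hbc, hb0, fun x y hy => by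
    simp [image_eq_zero_of_notMem_tsupport hy]⟩

theorem hasCompactSupport_tensor {a b : ℝ → ℂ} (ha : HasCompactSupport a)
    (hb : HasCompactSupport b) : HasCompactSupport (fun z : ℝ × ℝ => a z.1 * b z.2) := by
  refine HasCompactSupport.intro (IsCompact.prod ha hb) fun z hz => ?_
  rw [mem_prod, not_and_or] at hz
  rcases hz with h | h <;> simp [image_eq_zero_of_notMem_tsupport h]

/-- The function `x ↦ (2π)^{-1/2} a(x / 2π)`: if `a` is the Fourier transform of `A` with kernel
`e^{-2πisx}`, this is the Fourier transform of `A` with the normalization of `IsFourierFst`. -/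
noncomputable def rescale (a : 𝓢(ℝ, ℂ)) : 𝓢(ℝ, ℂ) :=
  ((1 / Real.sqrt (2 * Real.pi) : ℝ) : ℂ) •
    SchwartzMap.compCLMOfContinuousLinearEquiv ℂ
      (ContinuousLinearEquiv.unitsEquivAut ℝ
        (Units.mk0 ((2 * Real.pi)⁻¹ : ℝ) (by positivity))) a

theorem rescale_apply (a : 𝓢(ℝ, ℂ)) (x : ℝ) :
    rescale a x = ((1 / Real.sqrt (2 * Real.pi) : ℝ) : ℂ) * a (x * (2 * Real.pi)⁻¹) := by
  simp [rescale]

theorem hasCompactSupport_rescale {a : 𝓢(ℝ, ℂ)} (ha : HasCompactSupport a) :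
    HasCompactSupport (rescale a) := by
  have h : (rescale a : ℝ → ℂ) = fun x => ((1 / Real.sqrt (2 * Real.pi) : ℝ) : ℂ) *
      (a ∘ (Homeomorph.mulRight₀ (2 * Real.pi)⁻¹ (by positivity))) x := by
    ext x
    rw [rescale_apply]
    rfl
  rw [h]
  exact (ha.comp_homeomorph _).mul_left

theorem isFourierFst_dtTensor (a b : 𝓢(ℝ, ℂ)) (hbc : HasCompactSupport b)
    (hb0 : tsupport b ⊆ Ioi 0) :
    IsFourierFst (dtTensor (𝓕⁻ a) b hbc hb0) (dtTensor (rescale a) b hbc hb0) := by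
  intro x y
  change rescale a x * b y = _ * ∫ ξ, _ * ((𝓕⁻ a : 𝓢(ℝ, ℂ)) ξ * b y)
  have h : a (x * (2 * Real.pi)⁻¹) = ∫ ξ : ℝ, Complex.exp (-(Complex.I * x * ξ)) *
      (𝓕⁻ a : 𝓢(ℝ, ℂ)) ξ := by
    have h1 : a = 𝓕 (𝓕⁻ a : 𝓢(ℝ, ℂ)) := (FourierTransform.fourier_fourierInv_eq a).symm
    conv_lhs => rw [h1]
    rw [SchwartzMap.fourier_coe, Real.fourier_real_eq_integral_exp_smul]
    refine integral_congr_ae (Eventually.of_forall fun ξ => ?_)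
    simp only [smul_eq_mul]
    congr 2
    push_cast
    field_simp
  simp only [← mul_assoc]
  rw [integral_mul_const, ← h, rescale_apply]
  ring

/-- The value of a distribution with partial Fourier transform `g` on `a ⊗ b`. -/
theorem IsFourierTransform.apply_dtTensor {p q : ℝ≥0∞} [Fact (1 ≤ p)] {T : DtDual}
    {g : MixedLp lam p q} (hT : IsFourierTransform T g) (a b : 𝓢(ℝ, ℂ))
    (hbc : HasCompactSupport b) (hb0 : tsupport b ⊆ Ioi 0) :
    T (dtTensor (rescale a) b hbc hb0) =
      ∫ ξ : ℝ, (𝓕⁻ a : 𝓢(ℝ, ℂ)) ξ * ∫ y in Ioi (0 : ℝ), g.eval ξ y * b y := by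
  rw [hT _ _ (isFourierFst_dtTensor a b hbc hb0)]
  refine integral_congr_ae (Eventually.of_forall fun ξ => ?_)
  simp only
  rw [← integral_const_mul]
  refine integral_congr_ae (Eventually.of_forall fun y => ?_)
  simp only [dtTensor, tensor_apply]
  ring

/-- The value of a distribution represented by the function `F` on `a ⊗ b`. -/
theorem Represents.apply_dtTensor {T : DtDual} {F : ℂ → ℂ} (hF : Represents T F)
    {a b : 𝓢(ℝ, ℂ)} (hac : HasCompactSupport a)
    (hbc : HasCompactSupport b) (hb0 : tsupport b ⊆ Ioi 0) :
    T (dtTensor a b hbc hb0) =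
      ∫ z : ℝ × ℝ, F ((z.1 : ℂ) + (z.2 : ℂ) * Complex.I) * (a z.1 * b z.2) :=
  hF (dtTensor a b hbc hb0) (hasCompactSupport_tensor hac hbc)

section CauchyRiemann

variable {F : ℂ → ℂ}

theorem continuous_mul_tensor (hF : ContinuousOn F {z | 0 < z.im}) {a b : ℝ → ℂ}
    (ha : Continuous a) (hb : Continuous b) (hb0 : tsupport b ⊆ Ioi 0) :
    Continuous (fun z : ℝ × ℝ => F ((z.1 : ℂ) + (z.2 : ℂ) * Complex.I) * (a z.1 * b z.2)) := by
  rw [continuous_iff_continuousAt]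
  intro z
  by_cases hz : z.2 ∈ tsupport b
  · have hz0 : (0 : ℝ) < z.2 := hb0 hz
    refine ContinuousAt.mul ?_ (by fun_prop)
    refine ContinuousAt.comp (f := fun z : ℝ × ℝ => (z.1 : ℂ) + (z.2 : ℂ) * Complex.I) ?_
      (by fun_prop)
    exact hF.continuousAt ((isOpen_lt continuous_const Complex.continuous_im).mem_nhds
      (by simpa using hz0))
  · have h0 : (fun z : ℝ × ℝ => F ((z.1 : ℂ) + (z.2 : ℂ) * Complex.I) * (a z.1 * b z.2))
        =ᶠ[𝓝 z] fun _ => 0 := by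
      filter_upwards [continuous_snd.continuousAt.preimage_mem_nhds
        ((isClosed_tsupport b).isOpen_compl.mem_nhds hz)] with w hw
      have : b w.2 = 0 := image_eq_zero_of_notMem_tsupport hw
      simp [this]
    exact continuousAt_const.congr h0.symm

theorem integrable_mul_tensor (hF : ContinuousOn F {z | 0 < z.im}) {a b : ℝ → ℂ}
    (ha : Continuous a) (hb : Continuous b) (hac : HasCompactSupport a)
    (hbc : HasCompactSupport b) (hb0 : tsupport b ⊆ Ioi 0) :
    Integrable (fun z : ℝ × ℝ => F ((z.1 : ℂ) + (z.2 : ℂ) * Complex.I) * (a z.1 * b z.2)) :=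
  (continuous_mul_tensor hF ha hb hb0).integrable_of_hasCompactSupport
    (hasCompactSupport_tensor hac hbc).mul_left

theorem hasDerivAt_upperHalfPlane (hF : DifferentiableOn ℂ F {z | 0 < z.im}) (x : ℝ) {y : ℝ}
    (hy : 0 < y) : HasDerivAt F (deriv F ((x : ℂ) + (y : ℂ) * Complex.I))
      ((x : ℂ) + (y : ℂ) * Complex.I) :=
  (hF.differentiableAt ((isOpen_lt continuous_const Complex.continuous_im).mem_nhds
    (by simpa using hy))).hasDerivAt

theorem eq_zero_of_hasDerivAt_of_notMem_tsupport {b b' : ℝ → ℂ} (hb : ∀ y, HasDerivAt b (b' y) y)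
    {y : ℝ} (hy : y ∉ tsupport b) : b' y = 0 := by
  rw [← (hb y).deriv]
  exact image_eq_zero_of_notMem_tsupport fun h => hy (tsupport_deriv_subset h)

/-- The integral of `∂_x (F a b)` along a horizontal line vanishes. -/
theorem integral_deriv_horizontal (hF : DifferentiableOn ℂ F {z | 0 < z.im}) {a a' b : ℝ → ℂ}
    (ha : ∀ x, HasDerivAt a (a' x) x) (hb : Continuous b) (ha' : Continuous a')
    (hac : HasCompactSupport a) (hb0 : tsupport b ⊆ Ioi 0) (y : ℝ) :
    ∫ x : ℝ, (deriv F ((x : ℂ) + (y : ℂ) * Complex.I) * (a x * b y) +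
      F ((x : ℂ) + (y : ℂ) * Complex.I) * (a' x * b y)) = 0 := by
  have hopen : IsOpen {z : ℂ | 0 < z.im} := isOpen_lt continuous_const Complex.continuous_im
  have hFc := hF.continuousOn
  have hF'c : ContinuousOn (deriv F) {z | 0 < z.im} := (hF.deriv hopen).continuousOn
  have hac0 : Continuous a := continuous_iff_continuousAt.2 fun x => (ha x).continuousAt
  have hc : Continuous fun x : ℝ => (x, y) := by fun_prop
  refine integral_eq_zero_of_hasDerivAt_of_integrable
    (f := fun x : ℝ => F ((x : ℂ) + (y : ℂ) * Complex.I) * (a x * b y)) (fun x => ?_) ?_ ?_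
  · by_cases hy : y ∈ tsupport b
    · have h1 : HasDerivAt (fun x : ℝ => (x : ℂ) + (y : ℂ) * Complex.I) 1 x :=
        (Complex.ofRealCLM.hasDerivAt (x := x)).add_const _
      have h2 := ((hasDerivAt_upperHalfPlane hF x (hb0 hy)).comp x h1).mul
        ((ha x).mul_const (b y))
      exact h2.congr_deriv (by simp)
    · simpa [image_eq_zero_of_notMem_tsupport hy] using hasDerivAt_const x (0 : ℂ)
  · refine Continuous.integrable_of_hasCompactSupport ?_ (HasCompactSupport.intro hac fun x hx => ?_)
    · exact ((continuous_mul_tensor hF'c hac0 hb hb0).comp hc).add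
        ((continuous_mul_tensor hFc ha' hb hb0).comp hc)
    · simp [image_eq_zero_of_notMem_tsupport hx, eq_zero_of_hasDerivAt_of_notMem_tsupport ha hx]
  · refine Continuous.integrable_of_hasCompactSupport ?_ (HasCompactSupport.intro hac fun x hx => ?_)
    · exact (continuous_mul_tensor hFc hac0 hb hb0).comp hc
    · simp [image_eq_zero_of_notMem_tsupport hx]

/-- The integral of `∂_y (F a b)` along a vertical line vanishes. -/
theorem integral_deriv_vertical (hF : DifferentiableOn ℂ F {z | 0 < z.im}) {a b b' : ℝ → ℂ}
    (ha : Continuous a) (hb : ∀ y, HasDerivAt b (b' y) y) (hb' : Continuous b')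
    (hbc : HasCompactSupport b) (hb0 : tsupport b ⊆ Ioi 0) (hb0' : tsupport b' ⊆ Ioi 0) (x : ℝ) :
    ∫ y : ℝ, (Complex.I * (deriv F ((x : ℂ) + (y : ℂ) * Complex.I) * (a x * b y)) +
      F ((x : ℂ) + (y : ℂ) * Complex.I) * (a x * b' y)) = 0 := by
  have hopen : IsOpen {z : ℂ | 0 < z.im} := isOpen_lt continuous_const Complex.continuous_im
  have hFc := hF.continuousOn
  have hF'c : ContinuousOn (deriv F) {z | 0 < z.im} := (hF.deriv hopen).continuousOn
  have hbc0 : Continuous b := continuous_iff_continuousAt.2 fun x => (hb x).continuousAt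
  have hc : Continuous fun y : ℝ => (x, y) := by fun_prop
  refine integral_eq_zero_of_hasDerivAt_of_integrable
    (f := fun y : ℝ => F ((x : ℂ) + (y : ℂ) * Complex.I) * (a x * b y)) (fun y => ?_) ?_ ?_
  · by_cases hy : y ∈ tsupport b
    · have h1 : HasDerivAt (fun y : ℝ => (x : ℂ) + (y : ℂ) * Complex.I) Complex.I y := by
        simpa using ((Complex.ofRealCLM.hasDerivAt (x := y)).mul_const Complex.I).const_add
          (x : ℂ)
      have h2 := ((hasDerivAt_upperHalfPlane hF x (hb0 hy)).comp y h1).mul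
        ((hb y).const_mul (a x))
      exact h2.congr_deriv (by simp only [Function.comp]; ring)
    · have h0 : (fun y : ℝ => F ((x : ℂ) + (y : ℂ) * Complex.I) * (a x * b y))
          =ᶠ[𝓝 y] fun _ => 0 := by
        filter_upwards [(isClosed_tsupport b).isOpen_compl.mem_nhds hy] with w hw
        simp [image_eq_zero_of_notMem_tsupport hw]
      rw [image_eq_zero_of_notMem_tsupport hy, eq_zero_of_hasDerivAt_of_notMem_tsupport hb hy]
      simpa using (hasDerivAt_const y (0 : ℂ)).congr_of_eventuallyEq h0
  · refine Continuous.integrable_of_hasCompactSupport ?_ (HasCompactSupport.intro hbc fun y hy => ?_)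
    · exact (((continuous_mul_tensor hF'c ha hbc0 hb0).comp hc).const_mul Complex.I).add
        ((continuous_mul_tensor hFc ha hb' hb0').comp hc)
    · simp [image_eq_zero_of_notMem_tsupport hy, eq_zero_of_hasDerivAt_of_notMem_tsupport hb hy]
  · refine Continuous.integrable_of_hasCompactSupport ?_ (HasCompactSupport.intro hbc fun y hy => ?_)
    · exact (continuous_mul_tensor hFc ha hbc0 hb0).comp hc
    · simp [image_eq_zero_of_notMem_tsupport hy]

/-- The Cauchy–Riemann equation `(∂_x + i ∂_y) F = 0` in weak form. -/
theorem integral_cauchyRiemann (hF : DifferentiableOn ℂ F {z | 0 < z.im}) {a a' b b' : ℝ → ℂ}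
    (ha : ∀ x, HasDerivAt a (a' x) x) (hb : ∀ y, HasDerivAt b (b' y) y)
    (ha' : Continuous a') (hb' : Continuous b')
    (hac : HasCompactSupport a) (hbc : HasCompactSupport b) (hb0 : tsupport b ⊆ Ioi 0) :
    (∫ z : ℝ × ℝ, F ((z.1 : ℂ) + (z.2 : ℂ) * Complex.I) * (a' z.1 * b z.2)) +
      Complex.I * ∫ z : ℝ × ℝ, F ((z.1 : ℂ) + (z.2 : ℂ) * Complex.I) * (a z.1 * b' z.2) = 0 := by
  have hopen : IsOpen {z : ℂ | 0 < z.im} := isOpen_lt continuous_const Complex.continuous_im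
  have hFc := hF.continuousOn
  have hF'c : ContinuousOn (deriv F) {z | 0 < z.im} := (hF.deriv hopen).continuousOn
  have hac0 : Continuous a := continuous_iff_continuousAt.2 fun x => (ha x).continuousAt
  have hbc0 : Continuous b := continuous_iff_continuousAt.2 fun x => (hb x).continuousAt
  have ea : a' = deriv a := funext fun x => (ha x).deriv.symm
  have eb : b' = deriv b := funext fun x => (hb x).deriv.symm
  have hac' : HasCompactSupport a' := ea ▸ hac.deriv
  have hbc' : HasCompactSupport b' := eb ▸ hbc.deriv
  have hb0' : tsupport b' ⊆ Ioi 0 := by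
    rw [eb]
    exact tsupport_deriv_subset.trans hb0
  have i1 := integrable_mul_tensor hFc ha' hbc0 hac' hbc hb0
  have i2 := integrable_mul_tensor hFc hac0 hb' hac hbc' hb0'
  have i3 := integrable_mul_tensor hF'c hac0 hbc0 hac hbc hb0
  have hx : (∫ z : ℝ × ℝ, (deriv F ((z.1 : ℂ) + (z.2 : ℂ) * Complex.I) * (a z.1 * b z.2) +
      F ((z.1 : ℂ) + (z.2 : ℂ) * Complex.I) * (a' z.1 * b z.2))) = 0 := by
    refine (integral_prod_symm _ (i3.add i1)).trans ?_
    exact integral_eq_zero_of_ae (Eventually.of_forall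
      (integral_deriv_horizontal hF ha hbc0 ha' hac hb0))
  have hy : (∫ z : ℝ × ℝ, (Complex.I * (deriv F ((z.1 : ℂ) + (z.2 : ℂ) * Complex.I) *
      (a z.1 * b z.2)) + F ((z.1 : ℂ) + (z.2 : ℂ) * Complex.I) * (a z.1 * b' z.2))) = 0 := by
    refine (integral_prod _ ((i3.const_mul Complex.I).add i2)).trans ?_
    exact integral_eq_zero_of_ae (Eventually.of_forall
      (integral_deriv_vertical hF hac0 hb hb' hbc hb0 hb0'))
  rw [integral_add i3 i1] at hx
  rw [integral_add (i3.const_mul Complex.I) i2, integral_const_mul] at hy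
  linear_combination hx + Complex.I * hy - (∫ z : ℝ × ℝ, deriv F ((z.1 : ℂ) +
    (z.2 : ℂ) * Complex.I) * (a z.1 * b z.2)) * Complex.I_sq

end CauchyRiemann

end

/-! ### Uniqueness results for distributions on the line -/

section

section Fourier

/-- The smooth compactly supported real function `b`, as a complex Schwartz function. -/
noncomputable def ofRealSchwartz (b : ℝ → ℝ) (hb : ContDiff ℝ ∞ b) (hbc : HasCompactSupport b) :
    𝓢(ℝ, ℂ) :=
  HasCompactSupport.toSchwartzMap (f := fun y => (b y : ℂ))
    (hbc.comp_left (g := fun r : ℝ => (r : ℂ)) Complex.ofReal_zero)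
    (Complex.ofRealCLM.contDiff.comp hb)

@[simp]
theorem ofRealSchwartz_apply (b : ℝ → ℝ) (hb : ContDiff ℝ ∞ b) (hbc : HasCompactSupport b)
    (y : ℝ) : ofRealSchwartz b hb hbc y = (b y : ℂ) := rfl

theorem integral_fourier_mul_schwartz {f : ℝ → ℂ} (hf : Integrable f) (a : 𝓢(ℝ, ℂ)) :
    ∫ s, 𝓕 f s * a s = ∫ s, f s * (𝓕 a : 𝓢(ℝ, ℂ)) s := by
  have h := VectorFourier.integral_fourierIntegral_smul_eq_flip (L := innerₗ ℝ)
    Real.continuous_fourierChar continuous_inner hf (a.integrable (μ := volume))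
  simpa using! h

theorem integral_fourierInv_mul_schwartz {f : ℝ → ℂ} (hf : Integrable f) (a : 𝓢(ℝ, ℂ)) :
    ∫ s, 𝓕⁻ f s * a s = ∫ s, f s * (𝓕⁻ a : 𝓢(ℝ, ℂ)) s := by
  have h := integral_fourier_mul_schwartz hf
    (SchwartzMap.compCLMOfContinuousLinearEquiv ℂ (LinearIsometryEquiv.neg ℝ (E := ℝ)) a)
  have h1 : ∫ s, 𝓕⁻ f s * a s = ∫ s, 𝓕⁻ f (-s) * a (-s) :=
    (integral_neg_eq_self (fun s => 𝓕⁻ f s * a s) volume).symm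
  rw [h1]
  simp only [Real.fourierInv_eq_fourier_neg, neg_neg]
  refine h.trans ?_
  congr 1
  ext s
  congr 1
  rw [SchwartzMap.fourierInv_apply_eq]
  rw [SchwartzMap.compCLMOfContinuousLinearEquiv_apply, SchwartzMap.fourier_coe,
    SchwartzMap.fourier_coe, Function.comp, ]
  have := Real.fourier_comp_linearIsometry (LinearIsometryEquiv.neg ℝ (E := ℝ)) (⇑a) s
  exact this

/-- Two functions with the same integrals against Schwartz functions agree almost everywhere. -/
theorem ae_eq_zero_of_integral_mul_schwartz {f : ℝ → ℂ} (hf : LocallyIntegrable f)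
    (h : ∀ a : 𝓢(ℝ, ℂ), HasCompactSupport a → ∫ s, f s * a s = 0) : f =ᵐ[volume] 0 := by
  refine ae_eq_zero_of_integral_contDiff_smul_eq_zero hf fun b hb hbc => ?_
  have := h (ofRealSchwartz b hb hbc)
    (hbc.comp_left (g := fun r : ℝ => (r : ℂ)) Complex.ofReal_zero)
  rw [← this]
  refine integral_congr_ae (Eventually.of_forall fun s => ?_)
  simp [mul_comm]

theorem ae_eq_zero_of_fourierInv_eq_zero {f : ℝ → ℂ} (hf : Integrable f)
    (h : ∀ s, 𝓕⁻ f s = 0) : f =ᵐ[volume] 0 := by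
  refine ae_eq_zero_of_integral_mul_schwartz hf.locallyIntegrable fun a _ => ?_
  have h1 := integral_fourierInv_mul_schwartz hf (𝓕 a)
  rw [FourierTransform.fourierInv_fourier_eq] at h1
  rw [← h1]
  simp [h]

theorem fourierInv_compSub (a : 𝓢(ℝ, ℂ)) (s ξ : ℝ) :
    (𝓕⁻ (SchwartzMap.compSubConstCLM ℂ s a) : 𝓢(ℝ, ℂ)) ξ =
      Complex.exp (2 * Real.pi * (s * ξ) * Complex.I) * (𝓕⁻ a : 𝓢(ℝ, ℂ)) ξ := by
  rw [SchwartzMap.fourierInv_coe, SchwartzMap.fourierInv_coe, Real.fourierInv_eq',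
    Real.fourierInv_eq', ← integral_const_mul, ← integral_add_right_eq_self _ s]
  refine integral_congr_ae (Eventually.of_forall fun v => ?_)
  simp only [SchwartzMap.compSubConstCLM_apply, add_sub_cancel_right, smul_eq_mul]
  rw [← mul_assoc, ← Complex.exp_add]
  congr 2
  simp
  ring

/-- For every point `ξ` some smooth compactly supported function has an inverse Fourier transform
that does not vanish at `ξ`. -/
theorem exists_fourierInv_ne_zero (ξ : ℝ) :
    ∃ a : 𝓢(ℝ, ℂ), HasCompactSupport a ∧ (𝓕⁻ a : 𝓢(ℝ, ℂ)) ξ ≠ 0 := by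
  let χ : ContDiffBump (0 : ℝ) := ⟨1, 2, one_pos, one_lt_two⟩
  have hc : HasCompactSupport fun v : ℝ =>
      Complex.exp (-(2 * Real.pi * (v * ξ) * Complex.I)) * (χ v : ℂ) :=
    (χ.hasCompactSupport.comp_left (g := fun r : ℝ => (r : ℂ)) Complex.ofReal_zero).mul_left
  have hs : ContDiff ℝ ∞ fun v : ℝ =>
      Complex.exp (-(2 * Real.pi * (v * ξ) * Complex.I)) * (χ v : ℂ) := by
    refine ContDiff.mul (ContDiff.cexp ?_) (Complex.ofRealCLM.contDiff.comp χ.contDiff)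
    exact ((contDiff_const.mul (Complex.ofRealCLM.contDiff.mul contDiff_const)).mul
      contDiff_const).neg
  refine ⟨hc.toSchwartzMap hs, hc, ?_⟩
  have h : (𝓕⁻ (hc.toSchwartzMap hs) : 𝓢(ℝ, ℂ)) ξ = ((∫ v, χ v : ℝ) : ℂ) := by
    rw [SchwartzMap.fourierInv_coe, Real.fourierInv_eq', ← integral_complex_ofReal]
    refine integral_congr_ae (Eventually.of_forall fun v => ?_)
    simp only [HasCompactSupport.toSchwartzMap_toFun, smul_eq_mul]
    rw [← mul_assoc, ← Complex.exp_add]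
    have e : ((2 * Real.pi * inner ℝ v ξ : ℝ) : ℂ) * Complex.I +
        -(2 * Real.pi * (v * ξ) * Complex.I) = 0 := by
      simp
      ring
    rw [e, Complex.exp_zero, one_mul]
  rw [h]
  exact_mod_cast (χ.integral_pos (μ := volume)).ne'

/-- A function orthogonal to the inverse Fourier transforms of all smooth compactly supported
functions vanishes. Translating `a` modulates `𝓕⁻ a`, so `𝓕⁻ a · W` has vanishing Fourier
transform; no density of compactly supported functions in the Schwartz space is needed. -/
theorem ae_eq_zero_of_integral_fourierInv_mul {W : ℝ → ℂ}
    (hi : ∀ a : 𝓢(ℝ, ℂ), Integrable fun ξ => (𝓕⁻ a : 𝓢(ℝ, ℂ)) ξ * W ξ)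
    (h : ∀ a : 𝓢(ℝ, ℂ), HasCompactSupport a → ∫ ξ, (𝓕⁻ a : 𝓢(ℝ, ℂ)) ξ * W ξ = 0) :
    W =ᵐ[volume] 0 := by
  have key : ∀ a : 𝓢(ℝ, ℂ), HasCompactSupport a →
      (fun ξ => (𝓕⁻ a : 𝓢(ℝ, ℂ)) ξ * W ξ) =ᵐ[volume] 0 := by
    intro a ha
    refine ae_eq_zero_of_fourierInv_eq_zero (hi a) fun s => ?_
    have hc : HasCompactSupport (SchwartzMap.compSubConstCLM ℂ s a : 𝓢(ℝ, ℂ)) :=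
      ha.comp_homeomorph (Homeomorph.subRight s)
    rw [Real.fourierInv_eq', ← h _ hc]
    refine integral_congr_ae (Eventually.of_forall fun ξ => ?_)
    simp only [fourierInv_compSub, smul_eq_mul]
    rw [← mul_assoc]
    congr 3
    simp
  refine measure_null_of_locally_null _ fun ξ _ => ?_
  obtain ⟨a, ha, hne⟩ := exists_fourierInv_ne_zero ξ
  have hopen : {η | (𝓕⁻ a : 𝓢(ℝ, ℂ)) η ≠ 0} ∈ 𝓝 ξ :=
    (𝓕⁻ a : 𝓢(ℝ, ℂ)).continuous.continuousAt.eventually_ne hne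
  refine ⟨_, inter_mem_nhdsWithin _ hopen, measure_mono_null ?_ (key a ha)⟩
  rintro η ⟨h1, h2⟩ h3
  rcases mul_eq_zero.1 h3 with h4 | h4
  · exact h2 h4
  · exact h1 h4

end Fourier

section Constancy

theorem exists_Icc_of_isCompact_Ioi {K : Set ℝ} (hK : IsCompact K) (hK0 : K ⊆ Ioi 0) :
    ∃ r R : ℝ, 0 < r ∧ K ⊆ Icc r R := by
  rcases K.eq_empty_or_nonempty with he | hne
  · exact ⟨1, 1, one_pos, by simp [he]⟩
  · obtain ⟨r, hr, hr'⟩ := hK.exists_isLeast hne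
    obtain ⟨R, hR, hR'⟩ := hK.exists_isGreatest hne
    exact ⟨r, R, hK0 hr, fun y hy => ⟨hr' hy, hR' hy⟩⟩

/-- A locally integrable function on `(0, ∞)` with vanishing weak derivative is constant. -/
theorem exists_ae_eq_const_of_integral_deriv {h : ℝ → ℂ} (hh : LocallyIntegrableOn h (Ioi 0))
    (h0 : ∀ b : ℝ → ℝ, ContDiff ℝ ∞ b → HasCompactSupport b → tsupport b ⊆ Ioi 0 →
      ∫ y in Ioi (0 : ℝ), ((deriv b y : ℝ) : ℂ) * h y = 0) :
    ∃ c : ℂ, ∀ᵐ y, y ∈ Ioi (0 : ℝ) → h y = c := by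
  let χ : ContDiffBump (2 : ℝ) := ⟨1 / 2, 1, by norm_num, by norm_num⟩
  set ρ : ℝ → ℝ := χ.normed volume with hρ
  have hρs : ContDiff ℝ ∞ ρ := χ.contDiff_normed
  have hρc : HasCompactSupport ρ := χ.hasCompactSupport_normed
  have hρ0 : tsupport ρ ⊆ Ioi 0 := by
    rw [hρ, χ.tsupport_normed_eq, Real.closedBall_eq_Icc]
    exact fun y hy => lt_of_lt_of_le (by norm_num) hy.1
  have hint : ∀ b : ℝ → ℝ, Continuous b → HasCompactSupport b → tsupport b ⊆ Ioi 0 →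
      IntegrableOn (fun y => (b y : ℂ) * h y) (Ioi 0) := by
    intro b hb hbc hb0
    have h1 := integrableOn_mul_of_hasCompactSupport (b := fun y => (b y : ℂ)) hh (by fun_prop)
      (hbc.comp_left (g := fun r : ℝ => (r : ℂ)) Complex.ofReal_zero)
      ((closure_mono (fun y hy h => hy (by simp [h]) :
        Function.support (fun y => (b y : ℂ)) ⊆ Function.support b)).trans hb0)
    simpa only [mul_comm] using h1
  refine ⟨∫ y in Ioi (0 : ℝ), (ρ y : ℂ) * h y, ?_⟩
  set c := ∫ y in Ioi (0 : ℝ), (ρ y : ℂ) * h y with hc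
  have hmain := isOpen_Ioi.ae_eq_zero_of_integral_contDiff_smul_eq_zero
    (f := fun y => h y - c) (μ := volume) (U := Ioi (0 : ℝ))
    (hh.sub ((locallyIntegrable_const c).locallyIntegrableOn _)) ?_
  · filter_upwards [hmain] with y hy hy0
    exact sub_eq_zero.1 (hy hy0)
  intro b hb hbc hb0
  set m : ℝ := ∫ y, b y with hm
  -- `b - m ρ` has integral zero, so its primitive `B` is a test function
  set d : ℝ → ℝ := fun y => b y - m * ρ y with hd
  have hds : ContDiff ℝ ∞ d := hb.sub (contDiff_const.mul hρs)
  have hdc : HasCompactSupport d := hbc.sub hρc.mul_left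
  have hd0 : tsupport d ⊆ Ioi 0 := by
    refine (closure_mono (?_ : Function.support d ⊆ tsupport b ∪ tsupport ρ)).trans ?_
    · intro y hy
      by_contra hcon
      rw [mem_union, not_or] at hcon
      exact hy (by simp [hd, image_eq_zero_of_notMem_tsupport hcon.1,
        image_eq_zero_of_notMem_tsupport hcon.2])
    · rw [((isClosed_tsupport b).union (isClosed_tsupport ρ)).closure_eq]
      exact union_subset hb0 hρ0
  have hdi : Integrable d := hds.continuous.integrable_of_hasCompactSupport hdc
  have hdint : ∫ y, d y = 0 := by
    have e : ∫ y, d y = m - m * ∫ y, ρ y := by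
      rw [← integral_const_mul, hm]
      exact integral_sub (hb.continuous.integrable_of_hasCompactSupport hbc)
        ((hρs.continuous.integrable_of_hasCompactSupport hρc).const_mul m)
    rw [e, hρ, χ.integral_normed]
    ring
  obtain ⟨r, R, hr, hrR⟩ := exists_Icc_of_isCompact_Ioi hdc hd0
  set B : ℝ → ℝ := fun y => ∫ t in (0 : ℝ)..y, d t with hB
  have hBd : ∀ y, HasDerivAt B (d y) y := fun y =>
    intervalIntegral.integral_hasDerivAt_right (hds.continuous.intervalIntegrable _ _)
      (hds.continuous.stronglyMeasurableAtFilter _ _) hds.continuous.continuousAt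
  have hBderiv : deriv B = d := funext fun y => (hBd y).deriv
  have hBs : ContDiff ℝ ∞ B := by
    rw [contDiff_infty_iff_deriv, hBderiv]
    exact ⟨fun y => (hBd y).differentiableAt, hds⟩
  have hdz : ∀ t, t ∉ Icc r R → d t = 0 := fun t ht =>
    image_eq_zero_of_notMem_tsupport fun h => ht (hrR h)
  have hBz : ∀ y, y ∉ Icc r R → B y = 0 := by
    intro y hy
    rcases lt_or_ge y r with hlt | hge
    · refine intervalIntegral.integral_zero_ae (Eventually.of_forall fun t ht => hdz t fun h => ?_)
      have : t ≤ max 0 y := ht.2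
      rcases le_max_iff.1 this with h1 | h1 <;> linarith [h.1]
    · have hyR : R < y := lt_of_not_ge fun h => hy ⟨hge, h⟩
      have h0y : 0 ≤ y := hr.le.trans hge
      change ∫ t in (0 : ℝ)..y, d t = 0
      rw [intervalIntegral.integral_of_le h0y]
      refine Eq.trans ?_ hdint
      refine setIntegral_eq_integral_of_forall_compl_eq_zero fun t ht => hdz t fun h => ht ?_
      exact ⟨hr.trans_le h.1, h.2.trans hyR.le⟩
  have hBc : HasCompactSupport B := HasCompactSupport.intro isCompact_Icc hBz
  have hB0 : tsupport B ⊆ Ioi 0 := by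
    refine (closure_minimal (fun y hy => ?_) isClosed_Icc : tsupport B ⊆ Icc r R).trans
      fun y hy => hr.trans_le hy.1
    by_contra hcon
    exact hy (hBz y hcon)
  have h1 := h0 B hBs hBc hB0
  rw [hBderiv] at h1
  have h2 : ∫ y in Ioi (0 : ℝ), (d y : ℂ) * h y =
      (∫ y in Ioi (0 : ℝ), (b y : ℂ) * h y) - m * c := by
    rw [hc, ← integral_const_mul, ← integral_sub (hint b hb.continuous hbc hb0)
      ((hint ρ hρs.continuous hρc hρ0).const_mul _)]
    refine integral_congr_ae (Eventually.of_forall fun y => ?_)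
    simp only [hd]
    push_cast
    ring
  have hbS : ∀ y, y ∉ Ioi (0 : ℝ) → b y = 0 := fun y hy =>
    image_eq_zero_of_notMem_tsupport fun h => hy (hb0 h)
  have h3 : ∫ y, b y • (h y - c) = ∫ y in Ioi (0 : ℝ), ((b y : ℂ) * h y - (b y : ℂ) * c) := by
    rw [← setIntegral_eq_integral_of_forall_compl_eq_zero (s := Ioi (0 : ℝ))
      (fun y hy => by simp [hbS y hy])]
    refine integral_congr_ae (Eventually.of_forall fun y => ?_)
    simp [mul_sub]
  have hbi : Integrable fun y => (b y : ℂ) :=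
    (hb.continuous.integrable_of_hasCompactSupport hbc).ofReal
  have h4 : ∫ y in Ioi (0 : ℝ), (b y : ℂ) = m := by
    rw [setIntegral_eq_integral_of_forall_compl_eq_zero (fun y hy => by simp [hbS y hy]),
      integral_complex_ofReal]
  rw [h3, integral_sub (hint b hb.continuous hbc hb0) (hbi.integrableOn.mul_const c),
    integral_mul_const, h4, ← h2, h1]

end Constancy

section Countability

theorem continuous_integral_mul_continuousMap {K : Set ℝ} (hK : IsCompact K) {u : ℝ → ℂ}
    (hu : IntegrableOn u K) :
    Continuous fun v : C(K, ℂ) => ∫ y : K, u y * v y ∂(volume.comap Subtype.val) := by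
  have : CompactSpace K := isCompact_iff_compactSpace.1 hK
  have hu' : Integrable (fun y : K => u y) (volume.comap Subtype.val) :=
    (integrableOn_iff_comap_subtypeVal hK.measurableSet).1 hu
  refine continuous_iff_continuousAt.2 fun v₀ => ?_
  refine continuousAt_of_dominated (bound := fun y => ‖u y‖ * (‖v₀‖ + 1)) ?_ ?_
    (hu'.norm.mul_const _) ?_
  · exact Eventually.of_forall fun v => hu'.aestronglyMeasurable.mul
      v.continuous.aestronglyMeasurable
  · filter_upwards [Metric.ball_mem_nhds v₀ one_pos] with v hv
    refine Eventually.of_forall fun y => ?_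
    rw [norm_mul]
    gcongr
    have h1 : ‖v - v₀‖ < 1 := by simpa [dist_eq_norm] using hv
    calc ‖v y‖ ≤ ‖v‖ := v.norm_coe_le_norm y
      _ = ‖v₀ + (v - v₀)‖ := by rw [add_sub_cancel]
      _ ≤ ‖v₀‖ + 1 := (norm_add_le _ _).trans (by linarith)
  · exact Eventually.of_forall fun y =>
      (continuous_const.mul (continuous_eval_const y)).continuousAt

/-- If each test function `b` satisfies the weak equation `u_ξ' = -ξ u_ξ` for almost every `ξ`, then
for almost every `ξ` all test functions do: the pairs `(b, b')` are separable for uniform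
convergence on compact sets. -/
theorem ae_forall_integral_deriv_sub {u : ℝ → ℝ → ℂ}
    (hu : ∀ ξ, LocallyIntegrableOn (u ξ) (Ioi 0))
    (h : ∀ b : 𝓢(ℝ, ℂ), HasCompactSupport b → tsupport b ⊆ Ioi 0 →
      ∀ᵐ ξ : ℝ, ∫ y in Ioi (0 : ℝ), u ξ y * (deriv b y - ξ * b y) = 0) :
    ∀ᵐ ξ : ℝ, ∀ b : 𝓢(ℝ, ℂ), HasCompactSupport b → tsupport b ⊆ Ioi 0 →
      ∫ y in Ioi (0 : ℝ), u ξ y * (deriv b y - ξ * b y) = 0 := by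
  set K : ℕ → Set ℝ := fun n => Icc (1 / ((n : ℝ) + 1)) (n + 1) with hKdef
  have hKpos : ∀ n, K n ⊆ Ioi 0 := fun n y hy => lt_of_lt_of_le (by positivity) hy.1
  let j : ∀ n, {b : 𝓢(ℝ, ℂ) // tsupport b ⊆ K n} → C(K n, ℂ) × C(K n, ℂ) := fun n b =>
    (⟨fun y => b.1 y, b.1.continuous.comp continuous_subtype_val⟩,
      ⟨fun y => deriv b.1 y, (SchwartzMap.derivCLM ℂ ℂ b.1).continuous.comp
        continuous_subtype_val⟩)
  have hj : ∀ n ξ (b : {b : 𝓢(ℝ, ℂ) // tsupport b ⊆ K n}),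
      ∫ y in Ioi (0 : ℝ), u ξ y * (deriv b.1 y - ξ * b.1 y) =
        ∫ y : K n, u ξ y * ((j n b).2 - (ξ : ℂ) • (j n b).1) y ∂(volume.comap Subtype.val) := by
    intro n ξ b
    have e : ∫ y : K n, u ξ y * ((j n b).2 - (ξ : ℂ) • (j n b).1) y ∂(volume.comap Subtype.val) =
        ∫ y in K n, u ξ y * (deriv b.1 y - ξ * b.1 y) :=
      integral_subtype_comap measurableSet_Icc
        (fun y => u ξ y * (deriv b.1 y - ξ * b.1 y))
    rw [e]
    refine (setIntegral_eq_of_subset_of_forall_sdiff_eq_zero measurableSet_Ioi (hKpos n)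
      fun y hy => ?_)
    have h1 : y ∉ tsupport b.1 := fun h => hy.2 (b.2 h)
    have h2 : deriv b.1 y = 0 :=
      image_eq_zero_of_notMem_tsupport fun h => h1 (tsupport_deriv_subset h)
    simp [image_eq_zero_of_notMem_tsupport h1, h2]
  have hdense : ∀ n, ∃ D : Set {b : 𝓢(ℝ, ℂ) // tsupport b ⊆ K n}, D.Countable ∧
      range (j n) ⊆ closure (j n '' D) := by
    intro n
    have : CompactSpace (K n) := isCompact_iff_compactSpace.1 isCompact_Icc
    obtain ⟨S, hSc, hSd⟩ := TopologicalSpace.exists_countable_dense (range (j n))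
    refine ⟨rangeSplitting (j n) '' S, hSc.image _, ?_⟩
    rw [Subtype.dense_iff] at hSd
    refine hSd.trans (closure_mono ?_)
    rintro _ ⟨s, hs, rfl⟩
    exact ⟨_, ⟨s, hs, rfl⟩, apply_rangeSplitting (j n) s⟩
  choose D hDc hD using hdense
  have hae : ∀ᵐ ξ : ℝ, ∀ n, ∀ b ∈ D n,
      ∫ y in Ioi (0 : ℝ), u ξ y * (deriv b.1 y - ξ * b.1 y) = 0 := by
    rw [ae_all_iff]
    intro n
    rw [ae_ball_iff (hDc n)]
    intro b _
    exact h b.1 (HasCompactSupport.of_support_subset_isCompact isCompact_Icc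
      ((subset_tsupport _).trans b.2)) (b.2.trans (hKpos n))
  filter_upwards [hae] with ξ hξ b hbc hb0
  obtain ⟨n, hn⟩ : ∃ n, tsupport b ⊆ K n := by
    obtain ⟨r, R, hr, hrR⟩ := exists_Icc_of_isCompact_Ioi hbc hb0
    obtain ⟨n, hn⟩ := exists_nat_ge (max (1 / r) R)
    refine ⟨n, fun y hy => ⟨?_, ?_⟩⟩
    · refine le_trans ?_ (hrR hy).1
      rw [one_div_le (by positivity) hr]
      linarith [(le_max_left _ _).trans hn]
    · linarith [(hrR hy).2, (le_max_right _ _).trans hn]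
  rw [hj n ξ ⟨b, hn⟩]
  have : CompactSpace (K n) := isCompact_iff_compactSpace.1 isCompact_Icc
  have hcont : Continuous fun w : C(K n, ℂ) × C(K n, ℂ) =>
      ∫ y : K n, u ξ y * (w.2 - (ξ : ℂ) • w.1) y ∂(volume.comap Subtype.val) :=
    (continuous_integral_mul_continuousMap isCompact_Icc
      ((hu ξ).integrableOn_compact_subset (hKpos n) isCompact_Icc)).comp
      (continuous_snd.sub (continuous_fst.const_smul (ξ : ℂ)))
  have hcl : IsClosed {w : C(K n, ℂ) × C(K n, ℂ) |
      ∫ y : K n, u ξ y * (w.2 - (ξ : ℂ) • w.1) y ∂(volume.comap Subtype.val) = 0} := isClosed_eq hcont continuous_const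
  refine closure_minimal ?_ hcl (hD n ⟨⟨b, hn⟩, rfl⟩)
  rintro _ ⟨b', hb', rfl⟩
  exact (hj n ξ b').symm.trans (hξ n b' hb')

end Countability

end

/-! ### The Fourier transform of a holomorphic function -/

section

variable {lam : ℝ} {p q : ℝ≥0∞} [Fact (1 ≤ p)]

section Equation

theorem fourierInv_derivCLM (a : 𝓢(ℝ, ℂ)) (ξ : ℝ) :
    (𝓕⁻ (SchwartzMap.derivCLM ℂ ℂ a) : 𝓢(ℝ, ℂ)) ξ =
      -(2 * Real.pi * Complex.I * ξ) * (𝓕⁻ a : 𝓢(ℝ, ℂ)) ξ := by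
  have h : (𝓕⁻ (SchwartzMap.derivCLM ℂ ℂ a) : 𝓢(ℝ, ℂ)) ξ =
      𝓕 (deriv (a : ℝ → ℂ)) (-ξ) := by
    rw [SchwartzMap.fourierInv_coe, Real.fourierInv_eq_fourier_neg]
    rfl
  rw [h, Real.fourier_deriv a.integrable a.differentiable
    (SchwartzMap.derivCLM ℂ ℂ a).integrable, SchwartzMap.fourierInv_coe,
    Real.fourierInv_eq_fourier_neg]
  simp only [smul_eq_mul]
  push_cast
  ring

theorem hasDerivAt_rescale (a : 𝓢(ℝ, ℂ)) (x : ℝ) :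
    HasDerivAt (rescale a)
      (rescale (((2 * Real.pi : ℝ) : ℂ)⁻¹ • SchwartzMap.derivCLM ℂ ℂ a) x) x := by
  have h1 : HasDerivAt (fun x : ℝ => x * (2 * Real.pi)⁻¹) (2 * Real.pi)⁻¹ x := by
    simpa using (hasDerivAt_id x).mul_const (2 * Real.pi)⁻¹
  have h2 := ((a.differentiable _).hasDerivAt.scomp x h1).const_mul
    ((1 / Real.sqrt (2 * Real.pi) : ℝ) : ℂ)
  refine (h2.congr_deriv ?_).congr_of_eventuallyEq
    (Eventually.of_forall fun y => rescale_apply a y)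
  rw [rescale_apply]
  simp

/-- The product of a Schwartz function with a functional of `g` is integrable. -/
theorem integrable_schwartz_mul_clm [hq1 : Fact (1 ≤ q)] (a : 𝓢(ℝ, ℂ)) (g : MixedLp lam p q)
    (L : Lp ℂ p (nu lam) →L[ℂ] ℂ) : Integrable fun ξ => a ξ * L (g ξ) := by
  have hconj := ENNReal.HolderConjugate.inv_one_sub_inv' hq1.out
  have h1 : MemLp (fun ξ => L (g ξ)) q := L.comp_memLp g
  have h2 : MemLp a (1 - q⁻¹)⁻¹ volume := a.memLp _
  exact h2.integrable_mul h1

/-- The Fourier transform of the Cauchy–Riemann equation: `f̂(ξ, ·)` is a weak solution of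
`u' = -ξ u` on `(0, ∞)`. -/
theorem ae_integral_eval_deriv_sub (hlam : -1 < lam) [Fact (1 ≤ q)] {T : DtDual} {F : ℂ → ℂ}
    {g : MixedLp lam p q} (hT : IsFourierTransform T g)
    (hF : DifferentiableOn ℂ F {z | 0 < z.im}) (hR : Represents T F) (b : 𝓢(ℝ, ℂ))
    (hbc : HasCompactSupport b) (hb0 : tsupport b ⊆ Ioi 0) :
    ∀ᵐ ξ : ℝ, ∫ y in Ioi (0 : ℝ), g.eval ξ y * (deriv b y - ξ * b y) = 0 := by
  set b' := SchwartzMap.derivCLM ℂ ℂ b with hb'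
  have hb'e : (b' : ℝ → ℂ) = deriv b := rfl
  have hbc' : HasCompactSupport b' := by rw [hb'e]; exact hbc.deriv
  have hb0' : tsupport b' ⊆ Ioi 0 := by rw [hb'e]; exact tsupport_deriv_subset.trans hb0
  obtain ⟨L, hL⟩ := exists_clm_integral_mul (p := p) hlam b.continuous hbc hb0
  obtain ⟨L', hL'⟩ := exists_clm_integral_mul (p := p) hlam b'.continuous hbc' hb0'
  set d : 𝓢(ℝ, ℂ) → 𝓢(ℝ, ℂ) := fun a =>
    ((2 * Real.pi : ℝ) : ℂ)⁻¹ • SchwartzMap.derivCLM ℂ ℂ a with hd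
  have hdF : ∀ (a : 𝓢(ℝ, ℂ)) (ξ : ℝ), (𝓕⁻ (d a) : 𝓢(ℝ, ℂ)) ξ =
      -(Complex.I * ξ) * (𝓕⁻ a : 𝓢(ℝ, ℂ)) ξ := by
    intro a ξ
    rw [hd]
    simp only
    rw [FourierTransform.fourierInv_smul, smul_apply, fourierInv_derivCLM]
    have : (Real.pi : ℂ) ≠ 0 := by exact_mod_cast Real.pi_ne_zero
    simp only [smul_eq_mul]
    push_cast
    field_simp
  have hLI : ∀ a : 𝓢(ℝ, ℂ), Integrable fun ξ => (𝓕⁻ a : 𝓢(ℝ, ℂ)) ξ * L (g ξ) := fun a =>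
    integrable_schwartz_mul_clm _ g L
  have hLI' : ∀ a : 𝓢(ℝ, ℂ), Integrable fun ξ => (𝓕⁻ a : 𝓢(ℝ, ℂ)) ξ * L' (g ξ) := fun a =>
    integrable_schwartz_mul_clm _ g L'
  have e : ∀ (a : 𝓢(ℝ, ℂ)) (ξ : ℝ), (𝓕⁻ (d a) : 𝓢(ℝ, ℂ)) ξ * L (g ξ) +
      Complex.I * ((𝓕⁻ a : 𝓢(ℝ, ℂ)) ξ * L' (g ξ)) =
      Complex.I * ((𝓕⁻ a : 𝓢(ℝ, ℂ)) ξ * (L' (g ξ) - ξ * L (g ξ))) := by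
    intro a ξ
    rw [hdF]
    ring
  have hW := ae_eq_zero_of_integral_fourierInv_mul (W := fun ξ => L' (g ξ) - ξ * L (g ξ)) ?_ ?_
  · filter_upwards [hW] with ξ hξ
    have hξ' : L' (g ξ) - ξ * L (g ξ) = 0 := hξ
    rw [hL, hL', ← integral_const_mul, ← integral_sub] at hξ'
    · rw [← hξ']
      refine integral_congr_ae (Eventually.of_forall fun y => ?_)
      simp only [MixedLp.eval, hb'e]
      ring
    · exact integrableOn_mul_of_hasCompactSupport
        (locallyIntegrableOn_of_memLp_nu hlam Fact.out (Lp.memLp (g ξ))) b'.continuous hbc' hb0'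
    · exact (integrableOn_mul_of_hasCompactSupport
        (locallyIntegrableOn_of_memLp_nu hlam Fact.out (Lp.memLp (g ξ))) b.continuous hbc
        hb0).const_mul _
  · intro a
    have h1 := ((hLI (d a)).add ((hLI' a).const_mul Complex.I)).const_mul (-Complex.I)
    refine h1.congr (Eventually.of_forall fun ξ => ?_)
    simp only [Pi.add_apply, e]
    rw [← mul_assoc, neg_mul, Complex.I_mul_I]
    ring
  · intro a hac
    have hdc : HasCompactSupport (d a) := (hac.deriv).mul_left
    have h1 := hT.apply_dtTensor (d a) b hbc hb0
    have h2 := hT.apply_dtTensor a b' hbc' hb0'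
    rw [hR.apply_dtTensor (hasCompactSupport_rescale hdc) hbc hb0] at h1
    rw [hR.apply_dtTensor (hasCompactSupport_rescale hac) hbc' hb0'] at h2
    have h3 := integral_cauchyRiemann hF (hasDerivAt_rescale a)
      (fun y => (b.differentiable y).hasDerivAt) (rescale (d a)).continuous b'.continuous
      (hasCompactSupport_rescale hac) hbc hb0
    rw [h1] at h3
    simp only [hb'e] at h2
    rw [h2] at h3
    have h4 : ∫ ξ, Complex.I * ((𝓕⁻ a : 𝓢(ℝ, ℂ)) ξ * (L' (g ξ) - ξ * L (g ξ))) = 0 := by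
      simp only [← e]
      rw [integral_add (hLI (d a)) ((hLI' a).const_mul Complex.I), integral_const_mul]
      simp only [hL, hL']
      exact h3
    rw [integral_const_mul] at h4
    exact (mul_eq_zero.1 h4).resolve_left Complex.I_ne_zero

/-- The Fourier transform of a holomorphic element of `𝓛^{q,p}_λ(Π)` is `c(ξ) e^{-ξy}`, with `c`
supported on the positive half-line. -/
theorem exists_exponential_form (hlam : -1 < lam) (hp : p ≠ ⊤) [Fact (1 ≤ q)] {T : DtDual}
    {F : ℂ → ℂ} {g : MixedLp lam p q} (hT : IsFourierTransform T g)
    (hF : DifferentiableOn ℂ F {z | 0 < z.im}) (hR : Represents T F) :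
    ∃ c : ℝ → ℂ, Measurable c ∧ (∀ ξ ≤ 0, c ξ = 0) ∧
      ∀ᵐ ξ : ℝ, ∀ᵐ y ∂(nu lam), g.eval ξ y = c ξ * ((Real.exp (-(ξ * y)) : ℝ) : ℂ) := by
  have hloc : ∀ ξ : ℝ, LocallyIntegrableOn (g.eval ξ) (Ioi 0) := fun ξ =>
    locallyIntegrableOn_of_memLp_nu hlam Fact.out (Lp.memLp (g ξ))
  have hall := ae_forall_integral_deriv_sub hloc
    fun b hbc hb0 => ae_integral_eval_deriv_sub hlam hT hF hR b hbc hb0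
  -- multiplication by `e^{ξy}` reduces `u' = -ξ u` to `u' = 0`
  have hex : ∀ᵐ ξ : ℝ, ∃ c : ℂ, ∀ᵐ y ∂(nu lam),
      g.eval ξ y = c * ((Real.exp (-(ξ * y)) : ℝ) : ℂ) := by
    filter_upwards [hall] with ξ hξ
    have hconst : ∃ c : ℂ, ∀ᵐ y, y ∈ Ioi (0 : ℝ) →
        ((Real.exp (ξ * y) : ℝ) : ℂ) * g.eval ξ y = c := by
      refine exists_ae_eq_const_of_integral_deriv
        ((hloc ξ).continuousOn_mul (by fun_prop) isOpen_Ioi.isLocallyClosed) ?_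
      intro b hb hbc hb0
      have hs : ContDiff ℝ ∞ fun y => Real.exp (ξ * y) * b y :=
        (contDiff_const.mul contDiff_id).exp.mul hb
      have hsub : Function.support (fun y => Real.exp (ξ * y) * b y) ⊆ Function.support b :=
        fun y hy h => hy (by simp [h])
      have hsub' : Function.support (ofRealSchwartz _ hs hbc.mul_left) ⊆ Function.support b :=
        fun y hy h => hy (by simp [h])
      have h1 := hξ (ofRealSchwartz _ hs hbc.mul_left)
        (hbc.mono hsub') ((closure_mono hsub').trans hb0)
      rw [← h1]
      refine integral_congr_ae (Eventually.of_forall fun y => ?_)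
      have hd : deriv (ofRealSchwartz _ hs hbc.mul_left) y =
          ((ξ * Real.exp (ξ * y) * b y + Real.exp (ξ * y) * deriv b y : ℝ) : ℂ) := by
        have hb1 : HasDerivAt b (deriv b y) y :=
          (hb.differentiable (by simp) y).hasDerivAt
        have he : HasDerivAt (fun y => Real.exp (ξ * y)) (ξ * Real.exp (ξ * y)) y := by
          have := ((hasDerivAt_id y).const_mul ξ).exp
          refine this.congr_deriv ?_
          simp
          ring
        exact (he.mul hb1).ofReal_comp.deriv
      simp only [hd, ofRealSchwartz_apply]
      push_cast
      ring
    obtain ⟨c, hc⟩ := hconst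
    refine ⟨c, (ae_nu_iff hlam).2 ?_⟩
    filter_upwards [hc] with y hy hy0
    rw [← hy hy0, Real.exp_neg, Complex.ofReal_inv]
    have : ((Real.exp (ξ * y) : ℝ) : ℂ) ≠ 0 := by exact_mod_cast (Real.exp_pos _).ne'
    field_simp
  -- the coefficient is a quotient of measurable functions
  let χ : ContDiffBump (2 : ℝ) := ⟨1 / 2, 1, by norm_num, by norm_num⟩
  have hχ0 : tsupport χ ⊆ Ioi 0 := by
    rw [χ.tsupport_eq, Real.closedBall_eq_Icc]
    exact fun y hy => lt_of_lt_of_le (by norm_num) hy.1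
  have hχs : Function.support (fun y => (χ y : ℂ)) ⊆ Function.support χ :=
    fun y hy h => hy (by simp [h])
  have hχcont : Continuous fun y => (χ y : ℂ) := Complex.continuous_ofReal.comp χ.continuous
  obtain ⟨L, hL⟩ := exists_clm_integral_mul (p := p) hlam hχcont (χ.hasCompactSupport.mono hχs)
    ((closure_mono hχs).trans hχ0)
  set m : ℝ → ℝ := fun ξ => ∫ y in Ioi (0 : ℝ), Real.exp (-(ξ * y)) * χ y with hm
  have hmpos : ∀ ξ, 0 < m ξ := by
    intro ξ
    have hcont : Continuous fun y => Real.exp (-(ξ * y)) * χ y :=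
      (by fun_prop : Continuous fun y => Real.exp (-(ξ * y))).mul χ.continuous
    rw [hm]
    simp only
    rw [setIntegral_eq_integral_of_forall_compl_eq_zero fun y hy => by
      rw [image_eq_zero_of_notMem_tsupport fun h => hy (hχ0 h), mul_zero]]
    refine hcont.integral_pos_of_hasCompactSupport_nonneg_nonzero χ.hasCompactSupport.mul_left
      (fun y => mul_nonneg (Real.exp_pos _).le χ.nonneg) (x := 2) ?_
    rw [χ.one_of_mem_closedBall (by simp [χ.rIn_pos.le])]
    positivity
  have hmm : Measurable m := by
    refine (StronglyMeasurable.integral_prod_right'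
      (f := fun z : ℝ × ℝ => Real.exp (-(z.1 * z.2)) * χ z.2) ?_).measurable
    exact ((by fun_prop : Continuous fun z : ℝ × ℝ => Real.exp (-(z.1 * z.2))).mul
      (χ.continuous.comp continuous_snd)).stronglyMeasurable
  have hLm : Measurable fun ξ => L (g ξ) :=
    (L.continuous.comp_stronglyMeasurable (Lp.stronglyMeasurable g)).measurable
  refine ⟨(Ioi 0).indicator fun ξ => L (g ξ) / (m ξ : ℂ),
    (hLm.div (Complex.measurable_ofReal.comp hmm)).indicator measurableSet_Ioi,
    fun ξ hξ => indicator_of_notMem (by simpa using hξ) _, ?_⟩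
  filter_upwards [hex] with ξ hξ
  obtain ⟨c, hc⟩ := hξ
  rcases le_or_gt ξ 0 with hle | hpos
  · have hc0 : c = 0 := eq_zero_of_memLp_exp hlam Fact.out hp hle
      ((memLp_congr_ae hc).1 (Lp.memLp (g ξ)))
    rw [indicator_of_notMem (by simpa using hle)]
    simpa [hc0] using hc
  · have hcL : L (g ξ) = c * (m ξ : ℂ) := by
      rw [hL, hm]
      simp only
      rw [← integral_complex_ofReal, ← integral_const_mul]
      refine setIntegral_congr_ae measurableSet_Ioi ?_
      filter_upwards [(ae_nu_iff hlam).1 hc] with y hy hy0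
      have := hy hy0
      simp only [MixedLp.eval] at this
      rw [this]
      push_cast
      ring
    rw [indicator_of_mem (by exact hpos), hcL, mul_div_cancel_right₀ _
      (by exact_mod_cast (hmpos ξ).ne')]
    exact hc

end Equation

end

/-! ### The norm identity and the integral formula -/

section

variable {lam : ℝ} {p q : ℝ≥0∞} [Fact (1 ≤ p)] {T : DtDual} {c : ℝ → ℂ}

section Norm

theorem isFourierTransform_fourierFst (hT : T ∈ calL lam p q) :
    IsFourierTransform T (fourierFst lam p q T) := by
  have h : ∃ g : MixedLp lam p q, IsFourierTransform T g := hT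
  rw [fourierFst, dif_pos h]
  exact h.choose_spec

theorem kernel_zero_left (P x η : ℝ) :
    kernel P x 0 η = ((Real.exp (-(x * (P - 1) * η)) : ℝ) : ℂ) := by
  rw [kernel]
  push_cast
  rw [← Complex.exp_add]
  congr 1
  linear_combination (x * η : ℂ) * Complex.I_sq

theorem kernel_eq_mul (P x ξ η : ℝ) :
    kernel P x ξ η = Complex.exp (-(Complex.I * x * ξ)) * kernel P x 0 η := by
  rw [kernel, kernel, ← mul_assoc, ← Complex.exp_add]
  congr 2
  push_cast
  ring

theorem one_le_toReal (hp : p ≠ ⊤) : 1 ≤ p.toReal := by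
  have h1 : (1 : ℝ≥0∞) ≤ p := Fact.out
  simpa using ENNReal.toReal_mono hp h1

theorem ae_U1_eval (T : DtDual) :
    ∀ᵐ x : ℝ, ∀ᵐ y ∂(nu lam), (U1 lam p q T).eval x y =
      ((1 / Real.sqrt Real.pi : ℝ) : ℂ) * (fourierFst lam p q T).eval x y := by
  filter_upwards [Lp.coeFn_smul ((1 / Real.sqrt Real.pi : ℝ) : ℂ) (fourierFst lam p q T)] with x hx
  have h : (U1 lam p q T) x = ((1 / Real.sqrt Real.pi : ℝ) : ℂ) • (fourierFst lam p q T) x := hx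
  filter_upwards [Lp.coeFn_smul ((1 / Real.sqrt Real.pi : ℝ) : ℂ) ((fourierFst lam p q T) x)]
    with y hy
  rw [MixedLp.eval, h, hy]
  rfl

theorem integrable_exp_mul_exp_nu (hlam : -1 < lam) {P x : ℝ} (hP : 0 < P) (hx : 0 < x) (c : ℂ) :
    Integrable (fun y : ℝ => c * ((Real.exp (-(x * y)) : ℝ) : ℂ) *
      ((Real.exp (-(x * (P - 1) * y)) : ℝ) : ℂ)) (nu lam) ∧
    ∫ y : ℝ, c * ((Real.exp (-(x * y)) : ℝ) : ℂ) *
      ((Real.exp (-(x * (P - 1) * y)) : ℝ) : ℂ) ∂(nu lam) =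
        c * (((theta lam P x ^ P)⁻¹ : ℝ) : ℂ) := by
  have e : (fun y : ℝ => c * ((Real.exp (-(x * y)) : ℝ) : ℂ) *
      ((Real.exp (-(x * (P - 1) * y)) : ℝ) : ℂ)) =
      fun y => c * ((Real.exp (-(P * x * y)) : ℝ) : ℂ) := by
    ext y
    rw [mul_assoc, ← Complex.ofReal_mul, ← Real.exp_add]
    congr 4
    ring
  rw [e]
  refine ⟨((integral_exp_nu hlam (by positivity)).1.ofReal).const_mul c, ?_⟩
  rw [integral_const_mul, integral_complex_ofReal, integral_exp_nu_eq_theta hlam hP hx]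

/-- For an exponential profile, `R_λ` computes the coefficient, normalized by `θ`. -/
theorem ae_R_eq (hlam : -1 < lam) (hp : p ≠ ⊤)
    (hc : ∀ᵐ ξ : ℝ, ∀ᵐ y ∂(nu lam),
      (fourierFst lam p q T).eval ξ y = c ξ * ((Real.exp (-(ξ * y)) : ℝ) : ℂ)) :
    ∀ᵐ x : ℝ, 0 < x → R lam p q T x =
      ((1 / Real.sqrt Real.pi : ℝ) : ℂ) * c x / (theta lam p.toReal x : ℂ) := by
  have hP : 0 < p.toReal := zero_lt_one.trans_le (one_le_toReal hp)
  filter_upwards [hc, ae_U1_eval (lam := lam) (p := p) (q := q) T] with x h1 h2 hx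
  have hθ := theta_pos hlam hP hx
  rw [R, R0inv_U2 hlam hP hx]
  have e : ∫ t, (U1 lam p q T).eval x t * ((Real.exp (-(x * (p.toReal - 1) * t)) : ℝ) : ℂ)
      ∂(nu lam) = ∫ t, ((1 / Real.sqrt Real.pi : ℝ) : ℂ) * c x * ((Real.exp (-(x * t)) : ℝ) : ℂ) *
        ((Real.exp (-(x * (p.toReal - 1) * t)) : ℝ) : ℂ) ∂(nu lam) := by
    refine integral_congr_ae ?_
    filter_upwards [h1, h2] with y h3 h4
    rw [h4, h3]
    ring
  rw [e, (integrable_exp_mul_exp_nu hlam hP hx _).2, Real.rpow_sub hθ, Real.rpow_one]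
  have h5 : (((theta lam p.toReal x ^ p.toReal : ℝ)) : ℂ) ≠ 0 := by
    exact_mod_cast (Real.rpow_pos_of_pos hθ _).ne'
  have h6 : ((theta lam p.toReal x : ℝ) : ℂ) ≠ 0 := by exact_mod_cast hθ.ne'
  simp only [Complex.ofReal_div, Complex.ofReal_inv]
  field_simp

theorem norm_of_exponential (hlam : -1 < lam) (hp : p ≠ ⊤) {x : ℝ} (hx : 0 < x) {c : ℂ}
    {u : Lp ℂ p (nu lam)} (hu : ∀ᵐ y ∂(nu lam), u y = c * ((Real.exp (-(x * y)) : ℝ) : ℂ)) :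
    ‖u‖ = ‖c‖ / theta lam p.toReal x := by
  have hθ := theta_pos hlam (zero_lt_one.trans_le (one_le_toReal hp)) hx
  rw [Lp.norm_def, eLpNorm_congr_ae hu, eLpNorm_exp_nu hlam Fact.out hp hx,
    ENNReal.toReal_ofReal (by positivity)]

/-- `‖(U_{1,λ} f)(x, ·)‖ = |(R_λ f)(x)|` for almost every `x > 0`, and the left-hand side vanishes
for almost every `x < 0`. -/
theorem ae_norm_U1_eq (hlam : -1 < lam) (hp : p ≠ ⊤) (hc0 : ∀ ξ ≤ 0, c ξ = 0)
    (hc : ∀ᵐ ξ : ℝ, ∀ᵐ y ∂(nu lam),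
      (fourierFst lam p q T).eval ξ y = c ξ * ((Real.exp (-(ξ * y)) : ℝ) : ℂ)) :
    ∀ᵐ x : ℝ, ‖(U1 lam p q T) x‖ = ‖(Ioi (0 : ℝ)).indicator (R lam p q T) x‖ := by
  filter_upwards [hc, ae_U1_eval (lam := lam) (p := p) (q := q) T, ae_R_eq hlam hp hc]
    with x h1 h2 h3
  have h4 : ∀ᵐ y ∂(nu lam), (U1 lam p q T) x y =
      ((1 / Real.sqrt Real.pi : ℝ) : ℂ) * c x * ((Real.exp (-(x * y)) : ℝ) : ℂ) := by
    filter_upwards [h1, h2] with y h5 h6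
    rw [MixedLp.eval] at h6
    rw [h6, h5, mul_assoc]
  rcases le_or_gt x 0 with hx | hx
  · rw [indicator_of_notMem (by simpa using hx), norm_zero, norm_eq_zero, Lp.eq_zero_iff_ae_eq_zero]
    filter_upwards [h4] with y hy
    rw [hy, hc0 x hx]
    simp
  · have hx' : x ∈ Ioi (0 : ℝ) := hx
    have hθ := theta_pos hlam (zero_lt_one.trans_le (one_le_toReal hp)) hx
    rw [indicator_of_mem hx', norm_of_exponential hlam hp hx h4, h3 hx, norm_div,
      Complex.norm_real, Real.norm_of_nonneg hθ.le]

theorem measurable_theta (P : ℝ) : Measurable (theta lam P) := by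
  unfold theta
  fun_prop

theorem eLpNorm_R_eq (hlam : -1 < lam) (hp : p ≠ ⊤) (hc0 : ∀ ξ ≤ 0, c ξ = 0)
    (hc : ∀ᵐ ξ : ℝ, ∀ᵐ y ∂(nu lam),
      (fourierFst lam p q T).eval ξ y = c ξ * ((Real.exp (-(ξ * y)) : ℝ) : ℂ)) :
    eLpNorm (R lam p q T) q (volume.restrict (Ioi (0 : ℝ))) =
      eLpNorm (U1 lam p q T) q volume := by
  rw [← eLpNorm_indicator_eq_eLpNorm_restrict measurableSet_Ioi]
  exact (eLpNorm_congr_norm_ae (ae_norm_U1_eq hlam hp hc0 hc)).symm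

theorem memLp_R (hlam : -1 < lam) (hp : p ≠ ⊤) (hcm : Measurable c) (hc0 : ∀ ξ ≤ 0, c ξ = 0)
    (hc : ∀ᵐ ξ : ℝ, ∀ᵐ y ∂(nu lam),
      (fourierFst lam p q T).eval ξ y = c ξ * ((Real.exp (-(ξ * y)) : ℝ) : ℂ)) :
    MemLp (R lam p q T) q (volume.restrict (Ioi (0 : ℝ))) := by
  refine ⟨?_, ?_⟩
  · have hm : Measurable fun x => ((1 / Real.sqrt Real.pi : ℝ) : ℂ) * c x /
        (theta lam p.toReal x : ℂ) :=
      (hcm.const_mul _).div (Complex.measurable_ofReal.comp (measurable_theta _))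
    refine hm.aestronglyMeasurable.congr ?_
    filter_upwards [ae_restrict_of_ae (ae_R_eq hlam hp hc), ae_restrict_mem measurableSet_Ioi]
      with x h1 h2
    exact (h1 h2).symm
  · rw [eLpNorm_R_eq hlam hp hc0 hc]
    exact (Lp.memLp (U1 lam p q T)).2

theorem ae_integral_formula (hlam : -1 < lam) (hp : p ≠ ⊤)
    (hc : ∀ᵐ ξ : ℝ, ∀ᵐ y ∂(nu lam),
      (fourierFst lam p q T).eval ξ y = c ξ * ((Real.exp (-(ξ * y)) : ℝ) : ℂ)) :
    ∀ᵐ x ∂(volume.restrict (Ioi (0 : ℝ))),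
      Integrable (fun η : ℝ => (fourierFst lam p q T).eval x η * kernel p.toReal x 0 η) (nu lam) ∧
      R lam p q T x =
        ((1 / Real.sqrt 2 * theta lam p.toReal x ^ (p.toReal - 1) : ℝ) : ℂ) *
          ∫ η : ℝ, ((1 / Real.pi : ℝ) : ℂ) *
            (((Real.sqrt (2 * Real.pi) : ℝ) : ℂ) * (fourierFst lam p q T).eval x η) *
            kernel p.toReal x 0 η ∂(nu lam) := by
  have hP : 0 < p.toReal := zero_lt_one.trans_le (one_le_toReal hp)
  filter_upwards [ae_restrict_of_ae hc,
    ae_restrict_of_ae (ae_U1_eval (lam := lam) (p := p) (q := q) T),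
    ae_restrict_mem measurableSet_Ioi] with x h1 h2 hx
  refine ⟨?_, ?_⟩
  · refine (integrable_exp_mul_exp_nu hlam hP hx (c x)).1.congr ?_
    filter_upwards [h1] with y hy
    rw [hy, kernel_zero_left]
  · rw [R, R0inv_U2 hlam hP hx, Complex.ofReal_mul, mul_comm ((1 / Real.sqrt 2 : ℝ) : ℂ), mul_assoc,
      ← integral_const_mul ((1 / Real.sqrt 2 : ℝ) : ℂ)]
    congr 1
    refine integral_congr_ae ?_
    filter_upwards [h2] with y hy
    rw [hy, kernel_zero_left]
    have e : 1 / Real.sqrt Real.pi =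
        1 / Real.sqrt 2 * (1 / Real.pi) * Real.sqrt (2 * Real.pi) := by
      rw [Real.sqrt_mul zero_le_two]
      have h3 : Real.sqrt 2 ≠ 0 := by positivity
      have h4 : Real.sqrt Real.pi ≠ 0 := by positivity
      have h5 : Real.pi = Real.sqrt Real.pi * Real.sqrt Real.pi :=
        (Real.mul_self_sqrt Real.pi_pos.le).symm
      field_simp
      rw [sq, ← h5]
    rw [e]
    push_cast
    ring

end Norm

end

/-! ### Fourier transforms along horizontal lines -/

section

variable {lam : ℝ} {p q : ℝ≥0∞} [Fact (1 ≤ p)] {T : DtDual} {c : ℝ → ℂ} {F : ℂ → ℂ}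

section Slices

/-- `θ` grows more slowly than every exponential. -/
theorem exists_theta_le_exp (hlam : -1 < lam) {P ε : ℝ} (hP : 0 < P) (hε : 0 < ε) :
    ∃ C, 0 ≤ C ∧ ∀ x, 0 < x → theta lam P x ≤ C * Real.exp (ε * x) := by
  have hl : 0 < lam + 1 := by linarith
  have hG := Real.Gamma_pos_of_pos (by linarith : 0 < lam + 2)
  set s : ℝ := (lam + 1) / P with hs
  have hs0 : 0 < s := by positivity
  set K : ℝ := (P ^ (lam + 1) / (2 ^ lam * Real.Gamma (lam + 2))) ^ (1 / P) with hK
  refine ⟨K * (s / ε) ^ s, by positivity, fun x hx => ?_⟩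
  have e1 : theta lam P x = K * x ^ s := by
    rw [theta, hK, hs, mul_div_right_comm, Real.mul_rpow (by positivity) (by positivity),
      ← Real.rpow_mul hx.le, mul_one_div]
  have e2 : x ^ s = (s / ε) ^ s * (ε * x / s) ^ s := by
    rw [← Real.mul_rpow (by positivity) (by positivity)]
    congr 1
    field_simp
  have e3 : (ε * x / s) ^ s ≤ Real.exp (ε * x) := by
    calc (ε * x / s) ^ s ≤ Real.exp (ε * x / s) ^ s := by
          refine Real.rpow_le_rpow (by positivity) ?_ hs0.le
          linarith [Real.add_one_le_exp (ε * x / s)]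
      _ = Real.exp (ε * x) := by
          rw [← Real.exp_mul, div_mul_cancel₀ _ hs0.ne']
  rw [e1, e2, ← mul_assoc]
  gcongr

/-- The coefficient becomes integrable after multiplication with `e^{-ξy}`. -/
theorem integrable_coeff_mul_exp (hlam : -1 < lam) (hp : p ≠ ⊤) (hq1 : 1 ≤ q) (hq : q ≠ ⊤)
    {g : MixedLp lam p q} (hcm : Measurable c) (hc0 : ∀ ξ ≤ 0, c ξ = 0)
    (hc : ∀ᵐ ξ : ℝ, ∀ᵐ y ∂(nu lam), g.eval ξ y = c ξ * ((Real.exp (-(ξ * y)) : ℝ) : ℂ))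
    {y : ℝ} (hy : 0 < y) :
    Integrable fun ξ => c ξ * ((Real.exp (-(ξ * y)) : ℝ) : ℂ) := by
  have hP : 0 < p.toReal := zero_lt_one.trans_le (one_le_toReal hp)
  have hQ : 1 ≤ q.toReal := by simpa using ENNReal.toReal_mono hq hq1
  obtain ⟨C, hC, hθ⟩ := exists_theta_le_exp hlam hP (half_pos hy)
  have h1 : Integrable ((Ioi (0 : ℝ)).indicator fun ξ => Real.exp (-(y / 2) * ξ)) :=
    (integrable_indicator_iff measurableSet_Ioi).2 (exp_neg_integrableOn_Ioi 0 (half_pos hy))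
  have h2 : Integrable fun ξ => ‖g ξ‖ ^ q.toReal :=
    (Lp.memLp g).integrable_norm_rpow (zero_lt_one.trans_le hq1).ne' hq
  refine Integrable.mono' ((h1.add h2).const_mul C)
    (hcm.mul (by fun_prop)).aestronglyMeasurable ?_
  filter_upwards [hc] with ξ hξ
  rcases le_or_gt ξ 0 with hle | hpos
  · rw [hc0 ξ hle, zero_mul, norm_zero]
    have : 0 ≤ (Ioi (0 : ℝ)).indicator (fun ξ => Real.exp (-(y / 2) * ξ)) ξ :=
      indicator_nonneg (fun _ _ => (Real.exp_pos _).le) _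
    simp only [Pi.add_apply]
    positivity
  · have hpos' : ξ ∈ Ioi (0 : ℝ) := hpos
    have hθ0 := theta_pos hlam hP hpos
    have hn : ‖c ξ‖ = theta lam p.toReal ξ * ‖g ξ‖ := by
      rw [norm_of_exponential hlam hp hpos hξ]
      field_simp
    rw [norm_mul, Complex.norm_real, Real.norm_of_nonneg (Real.exp_pos _).le, hn]
    simp only [Pi.add_apply, indicator_of_mem hpos']
    have e1 : Real.exp (y / 2 * ξ) * Real.exp (-(ξ * y)) = Real.exp (-(y / 2) * ξ) := by
      rw [← Real.exp_add]
      congr 1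
      ring
    have e2 : Real.exp (-(y / 2) * ξ) ≤ 1 := Real.exp_le_one_iff.2 (by nlinarith)
    -- `e t ≤ e + t ^ q` for `0 ≤ e ≤ 1`, `0 ≤ t`, `1 ≤ q`
    have e3 : Real.exp (-(y / 2) * ξ) * ‖g ξ‖ ≤
        Real.exp (-(y / 2) * ξ) + ‖g ξ‖ ^ q.toReal := by
      have hE := (Real.exp_pos (-(y / 2) * ξ)).le
      have ht : 0 ≤ ‖g ξ‖ := norm_nonneg _
      rcases le_or_gt ‖g ξ‖ 1 with h3 | h3
      · have : 0 ≤ ‖g ξ‖ ^ q.toReal := by positivity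
        nlinarith
      · have : ‖g ξ‖ ≤ ‖g ξ‖ ^ q.toReal := Real.self_le_rpow_of_one_le h3.le hQ
        nlinarith
    calc theta lam p.toReal ξ * ‖g ξ‖ * Real.exp (-(ξ * y))
        ≤ C * Real.exp (y / 2 * ξ) * ‖g ξ‖ * Real.exp (-(ξ * y)) := by
          gcongr
          exact hθ ξ hpos
      _ = C * (Real.exp (-(y / 2) * ξ) * ‖g ξ‖) := by rw [← e1]; ring
      _ ≤ _ := by gcongr

theorem continuousOn_integral_slice (hF : ContinuousOn F {z | 0 < z.im}) {a : ℝ → ℂ}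
    (ha : Continuous a) (hac : HasCompactSupport a) :
    ContinuousOn (fun y : ℝ => ∫ x : ℝ, F ((x : ℂ) + (y : ℂ) * Complex.I) * a x) (Ioi 0) := by
  refine continuousOn_integral_of_compact_support (k := tsupport a) hac ?_ ?_
  · refine ContinuousOn.mul (hF.comp (by fun_prop) ?_) (by fun_prop)
    rintro ⟨y, x⟩ ⟨hy, -⟩
    simpa using hy
  · intro y x _ hx
    simp [image_eq_zero_of_notMem_tsupport hx]

theorem continuousOn_integral_coeff
    (hci : ∀ y, 0 < y → Integrable fun ξ => c ξ * ((Real.exp (-(ξ * y)) : ℝ) : ℂ))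
    (hc0 : ∀ ξ ≤ 0, c ξ = 0) (A : 𝓢(ℝ, ℂ)) :
    ContinuousOn (fun y : ℝ => ∫ ξ : ℝ, A ξ * (c ξ * ((Real.exp (-(ξ * y)) : ℝ) : ℂ))) (Ioi 0) := by
  intro y₀ hy₀
  have hy₀' : (0 : ℝ) < y₀ := hy₀
  obtain ⟨C, hC⟩ : ∃ C, ∀ ξ, ‖A ξ‖ ≤ C := ⟨_, A.norm_le_seminorm ℝ⟩
  have hC0 : 0 ≤ C := (norm_nonneg _).trans (hC 0)
  refine (continuousAt_of_dominated
    (bound := fun ξ => C * ‖c ξ * ((Real.exp (-(ξ * (y₀ / 2))) : ℝ) : ℂ)‖) ?_ ?_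
    ((hci _ (half_pos hy₀')).norm.const_mul C) ?_).continuousWithinAt
  · filter_upwards [Ioi_mem_nhds hy₀'] with y hy
    exact A.continuous.aestronglyMeasurable.mul (hci y hy).aestronglyMeasurable
  · filter_upwards [Ioi_mem_nhds (half_lt_self hy₀')] with y hy
    refine Eventually.of_forall fun ξ => ?_
    rw [norm_mul]
    gcongr
    · exact hC ξ
    · rw [norm_mul, norm_mul]
      rcases le_or_gt ξ 0 with hle | hpos
      · simp [hc0 ξ hle]
      · rw [Complex.norm_real, Complex.norm_real, Real.norm_of_nonneg (Real.exp_pos _).le,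
          Real.norm_of_nonneg (Real.exp_pos _).le]
        have : y₀ / 2 < y := hy
        gcongr
  · refine Eventually.of_forall fun ξ => Continuous.continuousAt (by fun_prop)

theorem integrable_prod_coeff
    (hci : ∀ y, 0 < y → Integrable fun ξ => c ξ * ((Real.exp (-(ξ * y)) : ℝ) : ℂ))
    (hcm : Measurable c) (hc0 : ∀ ξ ≤ 0, c ξ = 0) (A : 𝓢(ℝ, ℂ)) {b : ℝ → ℂ} (hb : Continuous b)
    (hbc : HasCompactSupport b) (hb0 : tsupport b ⊆ Ioi 0) :
    Integrable (fun z : ℝ × ℝ => A z.1 * (c z.1 * ((Real.exp (-(z.1 * z.2)) : ℝ) : ℂ)) * b z.2)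
      (volume.prod volume) := by
  obtain ⟨C, hC⟩ : ∃ C, ∀ ξ, ‖A ξ‖ ≤ C := ⟨_, A.norm_le_seminorm ℝ⟩
  have hC0 : 0 ≤ C := (norm_nonneg _).trans (hC 0)
  obtain ⟨r, R, hr, hrR⟩ := exists_Icc_of_isCompact_Ioi hbc hb0
  have h1 := ((hci r hr).norm.const_mul C).mul_prod
    (hb.integrable_of_hasCompactSupport hbc (μ := volume)).norm
  refine h1.mono' ?_ (Eventually.of_forall fun z => ?_)
  · have m1 : Measurable fun z : ℝ × ℝ => A z.1 := A.continuous.measurable.comp measurable_fst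
    have m2 : Measurable fun z : ℝ × ℝ => c z.1 := hcm.comp measurable_fst
    have m3 : Measurable fun z : ℝ × ℝ => b z.2 := hb.measurable.comp measurable_snd
    exact ((m1.mul (m2.mul (by fun_prop))).mul m3).aestronglyMeasurable
  · rw [norm_mul, norm_mul]
    by_cases hz : z.2 ∈ tsupport b
    · gcongr
      · exact hC _
      · rw [norm_mul, norm_mul]
        rcases le_or_gt z.1 0 with hle | hpos
        · simp [hc0 _ hle]
        · rw [Complex.norm_real, Complex.norm_real, Real.norm_of_nonneg (Real.exp_pos _).le,
            Real.norm_of_nonneg (Real.exp_pos _).le]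
          have := (hrR hz).1
          gcongr
    · simp [image_eq_zero_of_notMem_tsupport hz]

/-- On every horizontal line, the Fourier transform of `F` in the sense of distributions is
`√(2π) c(ξ) e^{-ξy}`. -/
theorem integral_slice_mul_rescale (hlam : -1 < lam) {g : MixedLp lam p q}
    (hT : IsFourierTransform T g) (hF : ContinuousOn F {z | 0 < z.im}) (hR : Represents T F)
    (hcm : Measurable c) (hc0 : ∀ ξ ≤ 0, c ξ = 0)
    (hci : ∀ y, 0 < y → Integrable fun ξ => c ξ * ((Real.exp (-(ξ * y)) : ℝ) : ℂ))
    (hc : ∀ᵐ ξ : ℝ, ∀ᵐ y ∂(nu lam), g.eval ξ y = c ξ * ((Real.exp (-(ξ * y)) : ℝ) : ℂ))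
    (a : 𝓢(ℝ, ℂ)) (hac : HasCompactSupport a) {y : ℝ} (hy : 0 < y) :
    ∫ x : ℝ, F ((x : ℂ) + (y : ℂ) * Complex.I) * rescale a x =
      ∫ ξ : ℝ, (𝓕⁻ a : 𝓢(ℝ, ℂ)) ξ * (c ξ * ((Real.exp (-(ξ * y)) : ℝ) : ℂ)) := by
  set A : 𝓢(ℝ, ℂ) := 𝓕⁻ a with hA
  have hac' := hasCompactSupport_rescale hac
  have hΦ := continuousOn_integral_slice hF (rescale a).continuous hac'
  have hΨ := continuousOn_integral_coeff hci hc0 A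
  suffices hae : ∀ᵐ y : ℝ, y ∈ Ioi (0 : ℝ) →
      (∫ x : ℝ, F ((x : ℂ) + (y : ℂ) * Complex.I) * rescale a x) -
        ∫ ξ : ℝ, A ξ * (c ξ * ((Real.exp (-(ξ * y)) : ℝ) : ℂ)) = 0 by
    refine Measure.eqOn_open_of_ae_eq (μ := volume) ?_ isOpen_Ioi hΦ hΨ hy
    rw [EventuallyEq, ae_restrict_iff' measurableSet_Ioi]
    filter_upwards [hae] with y h1 h2
    exact sub_eq_zero.1 (h1 h2)
  refine isOpen_Ioi.ae_eq_zero_of_integral_contDiff_smul_eq_zero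
    ((hΦ.sub hΨ).locallyIntegrableOn measurableSet_Ioi) fun b hb hbc hb0 => ?_
  set B := ofRealSchwartz b hb hbc with hB
  have hsub : Function.support B ⊆ Function.support b := fun y hy h => hy (by simp [hB, h])
  have hBc : HasCompactSupport B := hbc.mono hsub
  have hB0 : tsupport B ⊆ Ioi 0 := (closure_mono hsub).trans hb0
  have hbz : ∀ y, y ∉ Ioi (0 : ℝ) → B y = 0 := fun y hy =>
    image_eq_zero_of_notMem_tsupport fun h => hy (hB0 h)
  have h1 := hR.apply_dtTensor hac' hBc hB0
  rw [hT.apply_dtTensor a B hBc hB0] at h1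
  -- left-hand side
  have i1 := integrable_mul_tensor hF (rescale a).continuous B.continuous hac' hBc hB0
  have e1 : ∫ z : ℝ × ℝ, F ((z.1 : ℂ) + (z.2 : ℂ) * Complex.I) * (rescale a z.1 * B z.2) =
      ∫ y in Ioi (0 : ℝ), (∫ x : ℝ, F ((x : ℂ) + (y : ℂ) * Complex.I) * rescale a x) * B y := by
    rw [setIntegral_eq_integral_of_forall_compl_eq_zero fun y hy => by rw [hbz y hy, mul_zero]]
    refine (integral_prod_symm _ i1).trans ?_
    refine integral_congr_ae (Eventually.of_forall fun y => ?_)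
    simp only
    rw [← integral_mul_const]
    simp only [mul_assoc]
  -- right-hand side
  have i2 := integrable_prod_coeff hci hcm hc0 A B.continuous hBc hB0
  have e2 : ∫ ξ : ℝ, A ξ * ∫ y in Ioi (0 : ℝ), g.eval ξ y * B y =
      ∫ y in Ioi (0 : ℝ), (∫ ξ : ℝ, A ξ * (c ξ * ((Real.exp (-(ξ * y)) : ℝ) : ℂ))) * B y := by
    have e3 : ∫ ξ : ℝ, A ξ * ∫ y in Ioi (0 : ℝ), g.eval ξ y * B y =
        ∫ ξ : ℝ, ∫ y : ℝ, A ξ * (c ξ * ((Real.exp (-(ξ * y)) : ℝ) : ℂ)) * B y := by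
      refine integral_congr_ae ?_
      filter_upwards [hc] with ξ hξ
      have e4 : ∫ y in Ioi (0 : ℝ), A ξ * (c ξ * ((Real.exp (-(ξ * y)) : ℝ) : ℂ)) * B y =
          ∫ y : ℝ, A ξ * (c ξ * ((Real.exp (-(ξ * y)) : ℝ) : ℂ)) * B y :=
        setIntegral_eq_integral_of_forall_compl_eq_zero fun y hy => by rw [hbz y hy, mul_zero]
      rw [← e4, ← integral_const_mul]
      refine setIntegral_congr_ae measurableSet_Ioi ?_
      filter_upwards [(ae_nu_iff hlam).1 hξ] with y h2 h3
      rw [h2 h3]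
      ring
    rw [e3, integral_integral_swap i2,
      setIntegral_eq_integral_of_forall_compl_eq_zero fun y hy => by rw [hbz y hy, mul_zero]]
    simp only [integral_mul_const]
  rw [e1, e2] at h1
  have j1 := integrableOn_mul_of_hasCompactSupport
    (hΦ.locallyIntegrableOn measurableSet_Ioi (μ := volume)) B.continuous hBc hB0
  have j2 := integrableOn_mul_of_hasCompactSupport
    (hΨ.locallyIntegrableOn measurableSet_Ioi (μ := volume)) B.continuous hBc hB0
  rw [← setIntegral_eq_integral_of_forall_compl_eq_zero (s := Ioi (0 : ℝ)) fun y hy => by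
    have : b y = 0 := by simpa [hB] using hbz y hy
    rw [this, zero_smul]]
  rw [← sub_eq_zero.2 h1.symm, ← integral_sub j1 j2]
  refine integral_congr_ae (Eventually.of_forall fun y => ?_)
  simp only [hB, ofRealSchwartz_apply, Complex.real_smul]
  ring

/-- On a horizontal line where `F` is integrable, its Fourier transform is
`√(2π) c(ξ) e^{-ξy}` almost everywhere. -/
theorem ae_integral_slice_exp {y : ℝ}
    (hci : Integrable fun ξ => c ξ * ((Real.exp (-(ξ * y)) : ℝ) : ℂ))
    (hFi : Integrable fun x : ℝ => F ((x : ℂ) + (y : ℂ) * Complex.I))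
    (h : ∀ a : 𝓢(ℝ, ℂ), HasCompactSupport a →
      ∫ x : ℝ, F ((x : ℂ) + (y : ℂ) * Complex.I) * rescale a x =
        ∫ ξ : ℝ, (𝓕⁻ a : 𝓢(ℝ, ℂ)) ξ * (c ξ * ((Real.exp (-(ξ * y)) : ℝ) : ℂ))) :
    ∀ᵐ ξ : ℝ, ∫ x : ℝ, F ((x : ℂ) + (y : ℂ) * Complex.I) *
        Complex.exp (-(Complex.I * ξ * x)) =
      ((Real.sqrt (2 * Real.pi) : ℝ) : ℂ) * (c ξ * ((Real.exp (-(ξ * y)) : ℝ) : ℂ)) := by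
  have hpi : (0 : ℝ) < 2 * Real.pi := by positivity
  set k : ℝ → ℂ := fun ξ => c ξ * ((Real.exp (-(ξ * y)) : ℝ) : ℂ) with hk
  set G : ℝ → ℂ := fun x => F ((x : ℂ) + (y : ℂ) * Complex.I) with hG
  -- the slice, rescaled to the convention `e^{-2πisx}`
  set f : ℝ → ℂ := fun s => ((Real.sqrt (2 * Real.pi) : ℝ) : ℂ) * G (2 * Real.pi * s) with hf
  have hfi : Integrable f := (hFi.comp_mul_left' hpi.ne').const_mul _
  have hsq : ((Real.sqrt (2 * Real.pi) : ℝ) : ℂ) * ((Real.sqrt (2 * Real.pi) : ℝ) : ℂ) =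
      ((2 * Real.pi : ℝ) : ℂ) := by
    rw [← Complex.ofReal_mul, Real.mul_self_sqrt hpi.le]
  have hsq0 : ((Real.sqrt (2 * Real.pi) : ℝ) : ℂ) ≠ 0 := by
    exact_mod_cast (Real.sqrt_pos.2 hpi).ne'
  have hscale : ∀ H : ℝ → ℂ, ∫ s, H (2 * Real.pi * s) = ((2 * Real.pi : ℝ) : ℂ)⁻¹ * ∫ x, H x := by
    intro H
    rw [Measure.integral_comp_mul_left, abs_of_pos (by positivity), Complex.real_smul,
      Complex.ofReal_inv]
  have hfa : ∀ a : 𝓢(ℝ, ℂ), ∫ s, f s * a s = ∫ x, G x * rescale a x := by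
    intro a
    have e : ∀ s, f s * a s = ((2 * Real.pi : ℝ) : ℂ) *
        (fun x => G x * rescale a x) (2 * Real.pi * s) := by
      intro s
      simp only [hf, rescale_apply]
      have e1 : 2 * Real.pi * s * (2 * Real.pi)⁻¹ = s := by field_simp
      rw [e1, ← hsq, Complex.ofReal_div, Complex.ofReal_one]
      field_simp
    simp only [e]
    rw [integral_const_mul, hscale fun x => G x * rescale a x, ← mul_assoc, mul_inv_cancel₀ (by exact_mod_cast hpi.ne'),
      one_mul]
  have hkc : Continuous (𝓕⁻ k) := by
    have h1 : Continuous (𝓕 k) :=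
      VectorFourier.fourierIntegral_continuous Real.continuous_fourierChar
        (by exact continuous_inner) hci
    have h2 : 𝓕⁻ k = fun s => 𝓕 k (-s) := funext fun s => Real.fourierInv_eq_fourier_neg k s
    rw [h2]
    exact h1.comp continuous_neg
  have hfk : f =ᵐ[volume] 𝓕⁻ k := by
    have h1 : (fun s => f s - 𝓕⁻ k s) =ᵐ[volume] 0 := by
      refine ae_eq_zero_of_integral_mul_schwartz
        (hfi.locallyIntegrable.sub hkc.locallyIntegrable) fun a ha => ?_
      have h2 : ∫ s, f s * a s = ∫ s, 𝓕⁻ k s * a s := by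
        rw [hfa a, h a ha, integral_fourierInv_mul_schwartz hci]
        exact integral_congr_ae (Eventually.of_forall fun ξ => mul_comm _ _)
      have i1 : Integrable fun s => f s * a s := by
        obtain ⟨C, hC⟩ : ∃ C, ∀ ξ, ‖a ξ‖ ≤ C := ⟨_, a.norm_le_seminorm ℝ⟩
        exact hfi.mul_bdd a.continuous.aestronglyMeasurable (Eventually.of_forall hC)
      have i2 : Integrable fun s => 𝓕⁻ k s * a s :=
        (hkc.mul a.continuous).integrable_of_hasCompactSupport ha.mul_left
      simp only [sub_mul]
      rw [integral_sub i1 i2, h2, sub_self]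
    filter_upwards [h1] with s hs
    exact sub_eq_zero.1 hs
  have hfc : Continuous (𝓕 f) :=
    VectorFourier.fourierIntegral_continuous Real.continuous_fourierChar
      (by exact continuous_inner) hfi
  have hFf : 𝓕 f =ᵐ[volume] k := by
    have h1 : (fun s => 𝓕 f s - k s) =ᵐ[volume] 0 := by
      refine ae_eq_zero_of_integral_mul_schwartz
        (hfc.locallyIntegrable.sub hci.locallyIntegrable) fun a ha => ?_
      have h2 : ∫ s, 𝓕 f s * a s = ∫ s, k s * a s := by
        rw [integral_fourier_mul_schwartz hfi]
        have h3 := integral_fourierInv_mul_schwartz hci (𝓕 a)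
        rw [FourierTransform.fourierInv_fourier_eq] at h3
        rw [← h3]
        refine integral_congr_ae ?_
        filter_upwards [hfk] with s hs
        rw [hs]
      have i1 : Integrable fun s => 𝓕 f s * a s :=
        (hfc.mul a.continuous).integrable_of_hasCompactSupport ha.mul_left
      have i2 : Integrable fun s => k s * a s := by
        obtain ⟨C, hC⟩ : ∃ C, ∀ ξ, ‖a ξ‖ ≤ C := ⟨_, a.norm_le_seminorm ℝ⟩
        exact hci.mul_bdd a.continuous.aestronglyMeasurable (Eventually.of_forall hC)
      simp only [sub_mul]
      rw [integral_sub i1 i2, h2, sub_self]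
    filter_upwards [h1] with s hs
    exact sub_eq_zero.1 hs
  filter_upwards [hFf] with ξ hξ
  have e : 𝓕 f ξ = ((Real.sqrt (2 * Real.pi) : ℝ) : ℂ) * (((2 * Real.pi : ℝ) : ℂ)⁻¹ *
      ∫ x : ℝ, G x * Complex.exp (-(Complex.I * ξ * x))) := by
    rw [← hscale, ← integral_const_mul, Real.fourier_real_eq_integral_exp_smul]
    refine integral_congr_ae (Eventually.of_forall fun s => ?_)
    simp only [hf, smul_eq_mul]
    rw [mul_comm, mul_assoc]
    congr 3
    push_cast
    ring
  change ∫ x : ℝ, G x * Complex.exp (-(Complex.I * ξ * x)) = _ * k ξ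
  rw [← hξ, e, ← mul_assoc, ← mul_assoc, hsq, mul_inv_cancel₀ (by exact_mod_cast hpi.ne'), one_mul]

end Slices

end

/-! ### The ordinary integrals -/

section

variable {lam : ℝ} {p q : ℝ≥0∞} [Fact (1 ≤ p)] {T : DtDual} {c : ℝ → ℂ} {F : ℂ → ℂ}

section OrdinaryIntegral

/-- The identity for the Fourier transforms of the slices of `F`, with the order of the two
exceptional sets exchanged. -/
theorem ae_ae_integral_slice_exp (hlam : -1 < lam) (hF : ContinuousOn F {z | 0 < z.im})
    (hcm : Measurable c)
    (h : ∀ᵐ η : ℝ ∂(nu lam), ∀ᵐ ξ : ℝ, ∫ x : ℝ, F ((x : ℂ) + (η : ℂ) * Complex.I) *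
        Complex.exp (-(Complex.I * ξ * x)) =
      ((Real.sqrt (2 * Real.pi) : ℝ) : ℂ) * (c ξ * ((Real.exp (-(ξ * η)) : ℝ) : ℂ))) :
    ∀ᵐ ξ : ℝ, ∀ᵐ η : ℝ ∂(nu lam), ∫ x : ℝ, F ((x : ℂ) + (η : ℂ) * Complex.I) *
        Complex.exp (-(Complex.I * ξ * x)) =
      ((Real.sqrt (2 * Real.pi) : ℝ) : ℂ) * (c ξ * ((Real.exp (-(ξ * η)) : ℝ) : ℂ)) := by
  have : SFinite (nu lam) := by unfold nu; infer_instance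
  have hopen : IsOpen {z : ℂ | 0 < z.im} := isOpen_lt continuous_const Complex.continuous_im
  -- `F` is arbitrary below the real axis and has to be cut off there to be measurable
  set F' : ℂ → ℂ := {z | 0 < z.im}.indicator F with hF'
  have hF'm : Measurable F' := by
    classical
    rw [hF', ← piecewise_eq_indicator]
    exact hF.measurable_piecewise continuousOn_const hopen.measurableSet
  have hFF' : ∀ x η : ℝ, 0 < η → F' ((x : ℂ) + (η : ℂ) * Complex.I) =
      F ((x : ℂ) + (η : ℂ) * Complex.I) := by
    intro x η hη
    rw [hF', indicator_of_mem]
    simpa using hη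
  have hpos : ∀ᵐ η : ℝ ∂(nu lam), 0 < η := (ae_nu_iff hlam).2 (Eventually.of_forall fun _ h => h)
  have hmeas : MeasurableSet {z : ℝ × ℝ | ∫ x : ℝ, F' ((x : ℂ) + (z.2 : ℂ) * Complex.I) *
        Complex.exp (-(Complex.I * z.1 * x)) =
      ((Real.sqrt (2 * Real.pi) : ℝ) : ℂ) * (c z.1 * ((Real.exp (-(z.1 * z.2)) : ℝ) : ℂ))} := by
    refine measurableSet_eq_fun (StronglyMeasurable.measurable ?_) ?_
    · refine StronglyMeasurable.integral_prod_right' (f := fun w : (ℝ × ℝ) × ℝ =>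
        F' ((w.2 : ℂ) + (w.1.2 : ℂ) * Complex.I) * Complex.exp (-(Complex.I * w.1.1 * w.2))) ?_
      refine Measurable.stronglyMeasurable (Measurable.mul (hF'm.comp ?_) ?_) <;> fun_prop
    · exact ((hcm.comp measurable_fst).mul (by fun_prop)).const_mul _
  have h' := (Measure.ae_ae_comm (μ := volume) (ν := nu lam) (p := fun ξ η : ℝ =>
      ∫ x : ℝ, F' ((x : ℂ) + (η : ℂ) * Complex.I) * Complex.exp (-(Complex.I * ξ * x)) =
        ((Real.sqrt (2 * Real.pi) : ℝ) : ℂ) * (c ξ * ((Real.exp (-(ξ * η)) : ℝ) : ℂ))) hmeas).2 (by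
    filter_upwards [h, hpos] with η h1 h2
    filter_upwards [h1] with ξ h3
    simp only [hFF' _ _ h2]
    exact h3)
  filter_upwards [h'] with ξ h1
  filter_upwards [h1, hpos] with η h2 h3
  simp only [hFF' _ _ h3] at h2
  exact h2

theorem ae_iterated_integral_formula (hlam : -1 < lam) (hp : p ≠ ⊤) (hq1 : 1 ≤ q) (hq : q ≠ ⊤)
    (hT : T ∈ calL lam p q) (hF : DifferentiableOn ℂ F {z | 0 < z.im}) (hR : Represents T F)
    (hcm : Measurable c) (hc0 : ∀ ξ ≤ 0, c ξ = 0)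
    (hc : ∀ᵐ ξ : ℝ, ∀ᵐ y ∂(nu lam),
      (fourierFst lam p q T).eval ξ y = c ξ * ((Real.exp (-(ξ * y)) : ℝ) : ℂ))
    (hFi : ∀ᵐ η : ℝ ∂(nu lam), Integrable (fun ξ : ℝ => F ((ξ : ℂ) + (η : ℂ) * Complex.I))) :
    ∀ᵐ x ∂(volume.restrict (Ioi (0 : ℝ))),
      R lam p q T x =
        ((1 / Real.sqrt 2 * theta lam p.toReal x ^ (p.toReal - 1) : ℝ) : ℂ) *
          ∫ η : ℝ, (∫ ξ : ℝ, ((1 / Real.pi : ℝ) : ℂ) *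
            F ((ξ : ℂ) + (η : ℂ) * Complex.I) * kernel p.toReal x ξ η) ∂(nu lam) := by
  have hci : ∀ y, 0 < y → Integrable fun ξ => c ξ * ((Real.exp (-(ξ * y)) : ℝ) : ℂ) := fun y hy =>
    integrable_coeff_mul_exp hlam hp hq1 hq hcm hc0 hc hy
  have hpos : ∀ᵐ η : ℝ ∂(nu lam), 0 < η := (ae_nu_iff hlam).2 (Eventually.of_forall fun _ h => h)
  have hslice := ae_ae_integral_slice_exp hlam hF.continuousOn hcm (by
    filter_upwards [hFi, hpos] with η h1 h2
    exact ae_integral_slice_exp (hci η h2) h1 fun a ha =>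
      integral_slice_mul_rescale hlam (isFourierTransform_fourierFst hT) hF.continuousOn hR hcm hc0
        hci hc a ha h2)
  filter_upwards [ae_integral_formula hlam hp hc, ae_restrict_of_ae hslice, ae_restrict_of_ae hc]
    with x h1 h2 h3
  rw [h1.2]
  congr 1
  refine integral_congr_ae ?_
  filter_upwards [h2, h3] with η h4 h5
  have e : ∀ ξ : ℝ, ((1 / Real.pi : ℝ) : ℂ) * F ((ξ : ℂ) + (η : ℂ) * Complex.I) *
      kernel p.toReal x ξ η = ((1 / Real.pi : ℝ) : ℂ) * kernel p.toReal x 0 η *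
        (F ((ξ : ℂ) + (η : ℂ) * Complex.I) * Complex.exp (-(Complex.I * x * ξ))) := by
    intro ξ
    rw [kernel_eq_mul]
    ring
  simp only [e]
  rw [integral_const_mul, h4, h5]
  ring

theorem kernel_ne_zero (P x ξ η : ℝ) : kernel P x ξ η ≠ 0 :=
  mul_ne_zero (Complex.exp_ne_zero _) (by exact_mod_cast (Real.exp_pos _).ne')

/-- If the integrand of the formula is integrable over the half-plane for one `x`, then almost all
slices of `F` are integrable. -/
theorem ae_integrable_slice {P x : ℝ}
    (h : Integrable (fun w : ℝ × ℝ => F ((w.1 : ℂ) + (w.2 : ℂ) * Complex.I) *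
      kernel P x w.1 w.2) ((volume : Measure ℝ).prod (nu lam))) :
    ∀ᵐ η : ℝ ∂(nu lam), Integrable (fun ξ : ℝ => F ((ξ : ℂ) + (η : ℂ) * Complex.I)) := by
  have : SFinite (nu lam) := by unfold nu; infer_instance
  filter_upwards [h.prod_left_ae] with η hη
  have h1 := (hη.mul_bdd (c := 1) (g := fun ξ : ℝ => Complex.exp (Complex.I * x * ξ))
    (by fun_prop) (Eventually.of_forall fun ξ => ?_)).mul_const (kernel P x 0 η)⁻¹
  · refine h1.congr (Eventually.of_forall fun ξ => ?_)
    simp only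
    rw [kernel_eq_mul, Complex.exp_neg]
    have h2 := Complex.exp_ne_zero (Complex.I * x * ξ)
    have h3 := kernel_ne_zero P x 0 η
    field_simp
  · rw [mul_assoc, mul_comm, ← Complex.ofReal_mul, Complex.norm_exp_ofReal_mul_I]

end OrdinaryIntegral

end

end MixedFourier

/-- For `f ∈ 𝓐^{q,p}_λ(Π)` the function `R_λ f` lies in `L^q(0, ∞)` and has the same norm as `f`;
moreover `R_λ f` is given by the explicit integral formula, where the integral over `ξ` is the
Fourier transform of `f` in the first variable: the distributional one in general, the literal
integral as soon as it converges absolutely. -/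
theorem mainTheorem6 (lam : ℝ) (hlam : -1 < lam) (p q : ℝ≥0∞) [Fact (1 ≤ p)] [Fact (1 ≤ q)]
    (hp : p ≠ ∞) (hq : q ≠ ∞) (f : MixedFourier.DtDual) (hf : f ∈ MixedFourier.calA lam p q) :
    MemLp (MixedFourier.R lam p q f) q (volume.restrict (Ioi (0 : ℝ))) ∧
    MixedFourier.calLNorm lam p q f =
      (eLpNorm (MixedFourier.R lam p q f) q (volume.restrict (Ioi (0 : ℝ)))).toReal ∧
    (∀ᵐ x ∂(volume.restrict (Ioi (0 : ℝ))),
      Integrable (fun η : ℝ =>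
        (MixedFourier.fourierFst lam p q f).eval x η *
          MixedFourier.kernel p.toReal x 0 η) (MixedFourier.nu lam) ∧
      MixedFourier.R lam p q f x =
        ((1 / Real.sqrt 2 * MixedFourier.theta lam p.toReal x ^ (p.toReal - 1) : ℝ) : ℂ) *
          ∫ η : ℝ, ((1 / Real.pi : ℝ) : ℂ) *
            (((Real.sqrt (2 * Real.pi) : ℝ) : ℂ) *
              (MixedFourier.fourierFst lam p q f).eval x η) *
            MixedFourier.kernel p.toReal x 0 η ∂(MixedFourier.nu lam)) ∧
    ∀ F : ℂ → ℂ, DifferentiableOn ℂ F {z | 0 < z.im} → MixedFourier.Represents f F →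
      ((∀ᵐ η : ℝ ∂(MixedFourier.nu lam),
          Integrable (fun ξ : ℝ => F ((ξ : ℂ) + (η : ℂ) * Complex.I))) →
        ∀ᵐ x ∂(volume.restrict (Ioi (0 : ℝ))),
          MixedFourier.R lam p q f x =
            ((1 / Real.sqrt 2 * MixedFourier.theta lam p.toReal x ^ (p.toReal - 1) : ℝ) : ℂ) *
              ∫ η : ℝ, (∫ ξ : ℝ, ((1 / Real.pi : ℝ) : ℂ) *
                F ((ξ : ℂ) + (η : ℂ) * Complex.I) * MixedFourier.kernel p.toReal x ξ η)
                ∂(MixedFourier.nu lam)) ∧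
      ∀ᵐ x ∂(volume.restrict (Ioi (0 : ℝ))),
        Integrable (fun w : ℝ × ℝ => F ((w.1 : ℂ) + (w.2 : ℂ) * Complex.I) *
          MixedFourier.kernel p.toReal x w.1 w.2) (MixedFourier.mu lam) →
        MixedFourier.R lam p q f x =
          ((1 / Real.sqrt 2 * MixedFourier.theta lam p.toReal x ^ (p.toReal - 1) : ℝ) : ℂ) *
            ∫ w : ℝ × ℝ, F ((w.1 : ℂ) + (w.2 : ℂ) * Complex.I) *
              MixedFourier.kernel p.toReal x w.1 w.2 ∂(MixedFourier.mu lam) := by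
  obtain ⟨hfL, F₀, hF₀, hR₀⟩ := hf
  obtain ⟨c, hcm, hc0, hc⟩ := MixedFourier.exists_exponential_form hlam hp
    (MixedFourier.isFourierTransform_fourierFst hfL) hF₀ hR₀
  refine ⟨MixedFourier.memLp_R hlam hp hcm hc0 hc, ?_,
    MixedFourier.ae_integral_formula hlam hp hc, fun F hF hR => ?_⟩
  · rw [MixedFourier.eLpNorm_R_eq hlam hp hc0 hc, MixedFourier.calLNorm, Lp.norm_def]
  have hiter := MixedFourier.ae_iterated_integral_formula hlam hp Fact.out hq hfL hF hR hcm hc0 hc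
  refine ⟨hiter, ?_⟩
  have hpi : ENNReal.ofReal (1 / Real.pi) ≠ 0 := by
    simp [Real.pi_pos]
  have hsf : SFinite (MixedFourier.nu lam) := by unfold MixedFourier.nu; infer_instance
  -- Integrability over `Π` for one `x` already makes almost every slice `F(· + iη)` integrable, so
  -- the iterated formula applies.
  by_cases hex : ∃ x : ℝ, Integrable (fun w : ℝ × ℝ => F ((w.1 : ℂ) + (w.2 : ℂ) * Complex.I) *
      MixedFourier.kernel p.toReal x w.1 w.2) (MixedFourier.mu lam)
  · obtain ⟨x₀, hx₀⟩ := hex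
    rw [MixedFourier.mu, integrable_smul_measure hpi ENNReal.ofReal_ne_top] at hx₀
    filter_upwards [hiter (MixedFourier.ae_integrable_slice hx₀)] with x hx hi
    rw [MixedFourier.mu, integrable_smul_measure hpi ENNReal.ofReal_ne_top] at hi
    rw [hx, MixedFourier.mu, integral_smul_measure, integral_prod_symm _ hi,
      ENNReal.toReal_ofReal (by positivity), Complex.real_smul,
      ← integral_const_mul ((1 / Real.pi : ℝ) : ℂ)]
    congr 1
    refine integral_congr_ae (Filter.Eventually.of_forall fun η => ?_)
    simp only [mul_assoc]
    rw [integral_const_mul]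
  · exact Filter.Eventually.of_forall fun x hx => absurd ⟨x, hx⟩ hex
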